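/- All graphs are finite and loopless, but may have multiple edges and need not be connected. For a graph $G$ and $X\subseteq V(G)$ let $\partial_G(X)$ be the set of edges of $G$ with exactly one end in $X$; an edge set of the form $C=\partial_G(X)$ with $|C|=k$ is called a $k$-edge-cut. A graph is bridgeless if no edge is a bridge, i.e. an edge whose ends lie in different components after the edge is deleted. A nowhere-zero $3$-flow of $G$ is a pair $(D,f)$, where $D$ is an orientation of $E(G)$ and $f:E(G)\to\{\pm1,\pm2\}$, such that at each vertex $v$ the sum of $f$ over the arcs of $D$ with tail $v$ equals the sum of $f$ over the arcs of $D$ with head $v$. Theorem. Every bridgeless graph that has no $5$-edge-cut and at most three $3$-edge-cuts (counted as edge sets) admits a nowhere-zero $3$-flow. The bound three cannot be replaced by four: the complete graph $K_4$ is bridgeless, has no $5$-edge-cut and exactly four $3$-edge-cuts, and admits no nowhere-zero $3$-flow. -/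

import Mathlib

namespace Graph

/-- The edge-cut `∂(X)`: the set of edges of `G` with one end in `X` and the other end outside. -/
def edgeCut {α β : Type*} (G : Graph α β) (X : Set α) : Set β :=
  {e | ∃ x y, G.IsLink e x y ∧ x ∈ X ∧ y ∉ X}

/-- The set of all `k`-edge-cuts of `G`: the edge sets `C = ∂(X)` with `X ⊆ V(G)` and `|C| = k`.
Cuts are edge sets, so `∂(X)` and `∂(V(G) \ X)` are counted once. -/
def edgeCutsOfSize {α β : Type*} (G : Graph α β) (k : ℕ) : Set (Set β) :=
  {C | C.encard = k ∧ ∃ X ⊆ G.vertexSet, C = G.edgeCut X}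

/-- An edge `e` is a bridge if its two ends are in different components of `G - e`. -/
def IsBridge {α β : Type*} (G : Graph α β) (e : β) : Prop :=
  ∃ x y, G.IsLink e x y ∧ ¬ Relation.ReflTransGen (G.deleteEdges {e}).Adj x y

/-- A graph (connected or not) is bridgeless if none of its edges is a bridge. -/
def Bridgeless {α β : Type*} (G : Graph α β) : Prop :=
  ∀ e, ¬ G.IsBridge e

/-- An orientation of `E(G)`: each edge is assigned one of its ends as tail, the other as head. -/
structure EdgeOrientation {α β : Type*} (G : Graph α β) where
  tail : G.edgeSet → α
  head : G.edgeSet → α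
  isLink : ∀ e : G.edgeSet, G.IsLink e (tail e) (head e)

/-- `(D, f)` is a nowhere-zero 3-flow of `G`: `f` takes values in `{±1, ±2}`, and at each vertex
the sum of `f` over the outgoing arcs equals the sum over the incoming arcs. (The sums are finite
sums, as this is used for graphs with finitely many edges.) -/
def IsNowhereZeroThreeFlow {α β : Type*} (G : Graph α β) (D : G.EdgeOrientation)
    (f : G.edgeSet → ℤ) : Prop :=
  (∀ e, f e = 1 ∨ f e = -1 ∨ f e = 2 ∨ f e = -2) ∧
  ∀ v ∈ G.vertexSet, ∑ᶠ e ∈ {e | D.tail e = v}, f e = ∑ᶠ e ∈ {e | D.head e = v}, f e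

/-- `G` admits a nowhere-zero 3-flow. -/
def HasNowhereZeroThreeFlow {α β : Type*} (G : Graph α β) : Prop :=
  ∃ (D : G.EdgeOrientation) (f : G.edgeSet → ℤ), G.IsNowhereZeroThreeFlow D f

/-- The complete graph `K₄`. -/
def completeFour : Graph (Fin 4) (Sym2 (Fin 4)) :=
  Graph.ofSimpleGraph (SimpleGraph.completeGraph (Fin 4))

end Graph

/-! ### Networks: graphs with predirected edges to a root, and prescribed boundaries modulo 3. -/

section NetTheory

set_option linter.unusedSectionVars false

open Finset

/-! By Tutte's theorem (`Net.exists_int_flow`) it suffices to find a nowhere-zero flow modulo 3. A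
`Net` is a graph with one further root vertex whose edges are already directed: `i` and `j` count
them, and `b` is what the undecided edges must still produce. Solvability depends on the internal
edges and `b` alone; `i` and `j` matter only through `deg`, `bet` and `size`.

The engine is the extension theorem `Good.solvable`. For a set of degree d and boundary β let τ be
an integer with |τ| ≤ 3, τ ≡ d mod 2 and τ ≡ β mod 3. Then `CutOK` says d ≥ 4 + |τ| and `RootOK`
says d ≤ 4 + |τ|. The proof is by induction on `size`. A proper set of at least two vertices that is
`RootOK` is contracted, and its inside is then solved with the rest as root. Otherwise d ≥ 6 + |τ|
for all such sets, so they survive lifting a pair of edges or deleting one. A vertex with τ = 0 is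
dissolved by lifting its edges in pairs; during this it may violate the cut condition, hence the
exceptional set `W`. If no vertex has τ = 0, each vertex can lose an outgoing edge or an incoming
edge. An edge between suitable ends is directed and deleted; if all vertices are of one kind,
external edges at one end are changed by a multiple of 3 to make the deletion possible.

For the theorem, take a counterexample with fewest vertices. Flows across a cut of at most three
edges can be glued, so such cuts isolate single vertices of degree 3. These form a set T with |T| ≤
3, and proper nonempty subsets of U = V \ T have degree 4 or at least 6, which is `CutOK` for β = 0.
Directing the edges at T so that one vertex is a source and the others are sinks balances T, and the
extension theorem applies to U unless deg U is 6 or 9. In that case one external edge into U and one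
out of U are forgotten, making the root degree 4 or 7. This fails only if two vertices of T send all
their edges to one vertex of degree 7, and then those three vertices are cut off by a bridge. -/

/-- A finite multigraph with vertices `V` and edges `E`, edge `e` having ends `s e` and `t e`,
together with directed edges to and from an external vertex: `i v` of them leave `v`, and `j v` of
them enter `v`. The function `b` prescribes the boundary of a `ZMod 3`-flow on `E`. -/
structure Net (α ε : Type*) where
  V : Finset α
  E : Finset ε
  s : ε → α
  t : ε → α
  i : α → ℕ
  j : α → ℕ
  b : α → ZMod 3

namespace Net

variable {α ε : Type*} [DecidableEq α]

/-- `1` if exactly one of `x`, `y` is in `A`, else `0`. -/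
def cross (A : Finset α) (x y : α) : ℕ := if (x ∈ A ↔ y ∈ A) then 0 else 1

/-- The number of edges, external ones included, leaving `A`. -/
def deg (N : Net α ε) (A : Finset α) : ℕ :=
  ∑ e ∈ N.E, cross A (N.s e) (N.t e) + ∑ v ∈ A, (N.i v + N.j v)

/-- The prescribed boundary of `A` when the external edges are taken into account. -/
def bet (N : Net α ε) (A : Finset α) : ZMod 3 := ∑ v ∈ A, (N.b v + N.i v - N.j v)

/-- The boundary of `f` on the internal edges. -/
def div (N : Net α ε) (f : ε → ZMod 3) (v : α) : ZMod 3 :=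
  ∑ e ∈ N.E, f e * ((if N.s e = v then 1 else 0) - (if N.t e = v then 1 else 0))

def WF (N : Net α ε) : Prop := ∀ e ∈ N.E, N.s e ∈ N.V ∧ N.t e ∈ N.V

/-- There is a nowhere-zero function on the edges with the prescribed boundary. -/
def Solvable (N : Net α ε) : Prop :=
  ∃ f : ε → ZMod 3, (∀ e ∈ N.E, f e ≠ 0) ∧ ∀ v ∈ N.V, N.div f v = N.b v

/-- An internal edge weighs 4 so that deleting one pays for up to three new external edges, and a
crossing edge that becomes external still lowers the size. -/
def size (N : Net α ε) : ℕ := N.V.card + 4 * N.E.card + ∑ v ∈ N.V, (N.i v + N.j v)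

/-- The edge `e` has ends `x` and `y`. -/
def Joins (N : Net α ε) (e : ε) (x y : α) : Prop :=
  (N.s e = x ∧ N.t e = y) ∨ (N.s e = y ∧ N.t e = x)

lemma sum_div (N : Net α ε) (f : ε → ZMod 3) (A : Finset α) :
    ∑ v ∈ A, N.div f v =
      ∑ e ∈ N.E, f e * ((if N.s e ∈ A then 1 else 0) - (if N.t e ∈ A then 1 else 0)) := by
  unfold div
  rw [sum_comm]
  refine sum_congr rfl fun e _ => ?_
  rw [← mul_sum, sum_sub_distrib, sum_ite_eq, sum_ite_eq]

lemma sum_div_self {N : Net α ε} (hN : N.WF) (f : ε → ZMod 3) : ∑ v ∈ N.V, N.div f v = 0 := by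
  rw [sum_div]
  exact sum_eq_zero fun e he => by simp [hN e he]

/-- Gluing: use `g` on the edges inside `A` and `f` elsewhere. A vertex of `A` sees only `g`, since
the two agree on the edges leaving `A`. -/
lemma solvable_of_agree (N : Net α ε) (A : Finset α) (f g : ε → ZMod 3)
    (hf : ∀ e ∈ N.E, f e ≠ 0) (hg : ∀ e ∈ N.E, g e ≠ 0)
    (hfV : ∀ v ∈ N.V, v ∉ A → N.div f v = N.b v) (hgA : ∀ v ∈ N.V, v ∈ A → N.div g v = N.b v)
    (h : ∀ e ∈ N.E, ¬ (N.s e ∈ A ↔ N.t e ∈ A) → f e = g e) : N.Solvable := by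
  refine ⟨fun e => if N.s e ∈ A ∧ N.t e ∈ A then g e else f e, fun e he => ?_, fun v hv => ?_⟩
  · dsimp only
    split_ifs
    exacts [hg e he, hf e he]
  · by_cases hvA : v ∈ A
    · rw [← hgA v hv hvA]
      refine sum_congr rfl fun e he => ?_
      dsimp only
      split_ifs with h1 <;> try rfl
      all_goals by_cases h2 : (N.s e ∈ A ↔ N.t e ∈ A)
      all_goals first | (rw [h e he h2]) | (exfalso; simp_all)
    · rw [← hfV v hv hvA]
      refine sum_congr rfl fun e he => ?_
      dsimp only
      split_ifs <;> simp_all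

/-- Boundaries sum to zero, so the condition at one last vertex `x` is automatic. -/
lemma solvable_of_forall_ne {N : Net α ε} (hN : N.WF) (hb : ∑ v ∈ N.V, N.b v = 0) (x : α)
    (f : ε → ZMod 3) (hf : ∀ e ∈ N.E, f e ≠ 0)
    (hfV : ∀ v ∈ N.V, v ≠ x → N.div f v = N.b v) : N.Solvable := by
  refine ⟨f, hf, fun v hv => ?_⟩
  by_cases hvx : v = x
  · subst hvx
    have h1 := sum_div_self hN f
    rw [← add_sum_erase _ _ hv] at h1 hb
    rw [sum_congr rfl fun u hu => hfV u (mem_of_mem_erase hu) (ne_of_mem_erase hu)] at h1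
    exact add_right_cancel (h1.trans hb.symm)
  · exact hfV v hv hvx

/-! ### Restriction to a vertex set and contraction of a vertex set. -/

/-- The part of `N` inside `A`, the edges leaving `A` being directed according to `f`. -/
def sub (N : Net α ε) (A : Finset α) (f : ε → ZMod 3) : Net α ε where
  V := A
  E := N.E.filter fun e => N.s e ∈ A ∧ N.t e ∈ A
  s := N.s
  t := N.t
  i v := N.i v + ∑ e ∈ N.E.filter fun e => ¬ (N.s e ∈ A ↔ N.t e ∈ A),
    ((if N.s e = v ∧ f e = 1 then 1 else 0) + (if N.t e = v ∧ f e ≠ 1 then 1 else 0))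
  j v := N.j v + ∑ e ∈ N.E.filter fun e => ¬ (N.s e ∈ A ↔ N.t e ∈ A),
    ((if N.s e = v ∧ f e ≠ 1 then 1 else 0) + (if N.t e = v ∧ f e = 1 then 1 else 0))
  b v := N.b v - ∑ e ∈ N.E.filter fun e => ¬ (N.s e ∈ A ↔ N.t e ∈ A),
    f e * ((if N.s e = v then 1 else 0) - (if N.t e = v then 1 else 0))

lemma sub_wf (N : Net α ε) (A : Finset α) (f : ε → ZMod 3) : (N.sub A f).WF := fun e he => by
  simpa [sub] using (mem_filter.1 he).2

/-- Each edge leaving `A` becomes exactly one external edge at its end in `A`, so cuts inside `A`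
keep their size. -/
lemma sub_deg (N : Net α ε) {A B : Finset α} (f : ε → ZMod 3) (hB : B ⊆ A) :
    (N.sub A f).deg B = N.deg B := by
  have key : ∀ e, (∑ v ∈ B, (((if N.s e = v ∧ f e = 1 then 1 else 0) +
      (if N.t e = v ∧ f e ≠ 1 then 1 else 0)) + ((if N.s e = v ∧ f e ≠ 1 then 1 else 0) +
      (if N.t e = v ∧ f e = 1 then 1 else 0)))) =
      (if N.s e ∈ B then 1 else 0) + (if N.t e ∈ B then 1 else 0) := by
    intro e
    rw [← sum_ite_eq B (N.s e) (fun _ => 1), ← sum_ite_eq B (N.t e) (fun _ => 1),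
      ← sum_add_distrib]
    refine sum_congr rfl fun v _ => ?_
    by_cases f e = 1 <;> simp_all [add_comm]
  have h2 : ∑ v ∈ B, ((N.sub A f).i v + (N.sub A f).j v) = ∑ v ∈ B, (N.i v + N.j v) +
      ∑ e ∈ N.E.filter fun e => ¬ (N.s e ∈ A ↔ N.t e ∈ A),
        ((if N.s e ∈ B then 1 else 0) + (if N.t e ∈ B then 1 else 0)) := by
    rw [← sum_congr rfl fun e _ => key e, sum_comm, ← sum_add_distrib]
    refine sum_congr rfl fun v _ => ?_
    rw [sum_add_distrib]
    simp only [sub]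
    ring
  unfold deg
  rw [h2, add_left_comm, ← add_assoc, add_comm, ← add_assoc, add_comm _ (∑ v ∈ B, (N.i v + N.j v)),
      add_comm _ (∑ v ∈ B, (N.i v + N.j v)),
    add_assoc]
  congr 1
  simp only [sub, sum_filter]
  rw [← sum_add_distrib]
  refine sum_congr rfl fun e _ => ?_
  have hs := @hB (N.s e)
  have ht := @hB (N.t e)
  unfold cross
  split_ifs <;> first | rfl | (exfalso; tauto)

/-- The value of a crossing edge subtracted from `b` comes back through `i - j`. This needs `f e ≠
0`, so that a value other than 1 is -1. -/
lemma sub_bet (N : Net α ε) {A B : Finset α} {f : ε → ZMod 3} (hf : ∀ e ∈ N.E, f e ≠ 0) :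
    (N.sub A f).bet B = N.bet B := by
  refine sum_congr rfl fun v _ => ?_
  simp only [sub]
  push_cast
  have : ∀ e ∈ N.E.filter (fun e => ¬ (N.s e ∈ A ↔ N.t e ∈ A)),
      f e * ((if N.s e = v then 1 else 0) - (if N.t e = v then 1 else 0)) =
      ((if N.s e = v ∧ f e = 1 then 1 else 0) + (if N.t e = v ∧ f e ≠ 1 then 1 else 0)) -
      ((if N.s e = v ∧ f e ≠ 1 then 1 else 0) + (if N.t e = v ∧ f e = 1 then 1 else 0)) := by
    intro e he
    have := hf e (mem_filter.1 he).1
    generalize f e = c at *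
    by_cases h1 : N.s e = v <;> by_cases h2 : N.t e = v <;> simp only [h1, h2] <;> revert c <;>
      decide
  rw [sum_congr rfl this, sum_sub_distrib]
  ring

lemma sum_sub_b {N : Net α ε} (hN : N.WF) (hb : ∑ v ∈ N.V, N.b v = 0) {A : Finset α}
    (hA : A ⊆ N.V) {f : ε → ZMod 3} (hfV : ∀ v ∈ N.V, v ∉ A → N.div f v = N.b v) :
    ∑ v ∈ A, (N.sub A f).b v = 0 := by
  have h1 : ∑ v ∈ A, N.b v = ∑ v ∈ A, N.div f v := by
    have h2 := hb.trans (sum_div_self hN f).symm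
    rw [← sum_sdiff hA, ← sum_sdiff hA,
      sum_congr rfl fun v hv => hfV v (mem_sdiff.1 hv).1 (mem_sdiff.1 hv).2] at h2
    exact add_left_cancel h2
  simp only [sub]
  rw [sum_sub_distrib, h1, sum_div, sum_comm, sum_filter, ← sum_sub_distrib]
  refine sum_eq_zero fun e _ => ?_
  rw [← mul_sum, sum_sub_distrib, sum_ite_eq, sum_ite_eq]
  split_ifs <;> simp_all

/-- The second half of every contraction argument: `f` settles everything outside `A` and on the
boundary of `A`, and a solution of the restricted network replaces it inside. -/
lemma solvable_of_sub {N : Net α ε} {A : Finset α} {f : ε → ZMod 3}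
    (hf : ∀ e ∈ N.E, f e ≠ 0) (hfV : ∀ v ∈ N.V, v ∉ A → N.div f v = N.b v)
    (h : (N.sub A f).Solvable) : N.Solvable := by
  obtain ⟨g, hg, hgA⟩ := h
  refine N.solvable_of_agree A f (fun e => if N.s e ∈ A ∧ N.t e ∈ A then g e else f e) hf ?_ hfV
    ?_ ?_
  · intro e he
    split_ifs with h1
    exacts [hg e (mem_filter.2 ⟨he, h1⟩), hf e he]
  · intro v hv hvA
    have h1 := hgA v hvA
    simp only [sub, div] at h1
    rw [eq_sub_iff_add_eq, sum_filter, sum_filter, ← sum_add_distrib] at h1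
    rw [← h1]
    refine sum_congr rfl fun e _ => ?_
    have h2 : N.s e ∉ A → N.s e ≠ v := fun hs h => hs (h ▸ hvA)
    have h3 : N.t e ∉ A → N.t e ≠ v := fun ht h => ht (h ▸ hvA)
    by_cases hs : N.s e ∈ A <;> by_cases ht : N.t e ∈ A
    · simp only [hs, ht, and_self, if_true, not_true, if_false, add_zero]
      rfl
    · simp [hs, ht]
    · simp [hs, ht]
    · simp [hs, ht, h2 hs, h3 ht]
  · intro e he h1
    rw [if_neg]
    tauto

/-- The graph obtained by identifying all vertices of `A` with `a`. -/
def contract (N : Net α ε) (A : Finset α) (a : α) : Net α ε where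
  V := insert a (N.V \ A)
  E := N.E
  s e := if N.s e ∈ A then a else N.s e
  t e := if N.t e ∈ A then a else N.t e
  i v := if v = a then ∑ u ∈ A, N.i u else N.i v
  j v := if v = a then ∑ u ∈ A, N.j u else N.j v
  b v := if v = a then ∑ u ∈ A, N.b u else N.b v

/-- The set of vertices that become `B` when `A` is identified with `a`. -/
def expand (A : Finset α) (a : α) (B : Finset α) : Finset α := if a ∈ B then B ∪ A else B

lemma contract_wf {N : Net α ε} (hN : N.WF) (A : Finset α) (a : α) : (N.contract A a).WF := by
  intro e he
  have := hN e he
  simp only [contract, mem_insert, mem_sdiff]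
  split_ifs <;> tauto

lemma sum_contract {M : Type*} [AddCommMonoid M] {N : Net α ε} {A B : Finset α} {a : α}
    (ha : a ∈ A) (hB : B ⊆ insert a (N.V \ A)) (g : α → M) :
    ∑ v ∈ B, (if v = a then ∑ u ∈ A, g u else g v) = ∑ v ∈ expand A a B, g v := by
  have hBA : Disjoint (B.erase a) A := by
    rw [disjoint_left]
    intro v hv
    have := hB (mem_of_mem_erase hv)
    rw [mem_insert, mem_sdiff] at this
    exact (this.resolve_left (ne_of_mem_erase hv)).2
  unfold expand
  split_ifs with h
  · have : B ∪ A = B.erase a ∪ A := by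
      ext v
      by_cases hv : v = a <;> simp_all
    rw [this, sum_union hBA, ← sum_erase_add _ _ h, if_pos rfl]
    congr 1
    exact sum_congr rfl fun v hv => if_neg (ne_of_mem_erase hv)
  · exact sum_congr rfl fun v hv => if_neg (by rintro rfl; exact h hv)

lemma mem_expand {N : Net α ε} {A B : Finset α} {a : α} 
    (hB : B ⊆ insert a (N.V \ A)) (v : α) :
    v ∈ expand A a B ↔ (if v ∈ A then a else v) ∈ B := by
  have h1 : v ∈ B → v = a ∨ v ∉ A := fun h => by
    have := hB h
    simp at this
    tauto
  unfold expand
  by_cases hv : v ∈ A <;> by_cases haB : a ∈ B <;> simp_all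
  rintro h
  simp_all

lemma contract_deg (N : Net α ε) {A B : Finset α} {a : α} (ha : a ∈ A)
    (hB : B ⊆ insert a (N.V \ A)) : (N.contract A a).deg B = N.deg (expand A a B) := by
  unfold deg
  congr 1
  · refine sum_congr rfl fun e _ => ?_
    exact if_congr (iff_congr (mem_expand hB _).symm (mem_expand hB _).symm) rfl rfl
  · rw [← sum_contract ha hB]
    refine sum_congr rfl fun v _ => ?_
    simp only [contract]
    split_ifs <;> simp [sum_add_distrib]

lemma contract_bet (N : Net α ε) {A B : Finset α} {a : α} (ha : a ∈ A)
    (hB : B ⊆ insert a (N.V \ A)) : (N.contract A a).bet B = N.bet (expand A a B) := by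
  unfold bet
  rw [← sum_contract ha hB]
  refine sum_congr rfl fun v _ => ?_
  simp only [contract]
  split_ifs <;> simp [sum_add_distrib]

lemma expand_contract_V {N : Net α ε} {A : Finset α} {a : α} (ha : a ∈ A) (hA : A ⊆ N.V) :
    expand A a (insert a (N.V \ A)) = N.V := by
  ext v
  have := @hA v
  by_cases v = a <;> by_cases v ∈ A <;> simp_all [expand]

lemma expand_subset {N : Net α ε} {A B : Finset α} {a : α} (ha : a ∈ A) (hA : A ⊆ N.V)
    (hB : B ⊆ insert a (N.V \ A)) : expand A a B ⊆ N.V := by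
  intro v hv
  rw [mem_expand hB] at hv
  split_ifs at hv with h
  · exact hA h
  · have := hB hv
    simp at this
    rcases this with rfl | h
    exacts [hA ha, h.1]

lemma expand_ne {N : Net α ε} {A B : Finset α} {a : α} (ha : a ∈ A) (hA : A ⊆ N.V)
    (hB : B ⊆ insert a (N.V \ A)) (hBV : B ≠ insert a (N.V \ A)) : expand A a B ≠ N.V := by
  intro h
  refine hBV (subset_antisymm hB fun v hv => ?_)
  have h1 := mem_expand hB v
  rw [mem_insert, mem_sdiff] at hv
  rw [h] at h1
  rcases hv with rfl | hv
  · simpa [ha, hA ha] using h1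
  · simpa [hv.1, hv.2] using h1

lemma contract_div {N : Net α ε} {A : Finset α} {a : α} (ha : a ∈ A) (f : ε → ZMod 3) {v : α}
    (hv : v ∉ A) : (N.contract A a).div f v = N.div f v := by
  have hva : a ≠ v := fun h => hv (h ▸ ha)
  have : ∀ x, (if x ∈ A then a else x) = v ↔ x = v := fun x => by
    split_ifs with h
    · simp only [hva, false_iff]
      exact fun h1 => hv (h1 ▸ h)
    · rfl
  simp only [div, contract, this]

lemma sum_contract_b {N : Net α ε} {A : Finset α} {a : α} (ha : a ∈ A) (hA : A ⊆ N.V) :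
    ∑ v ∈ (N.contract A a).V, (N.contract A a).b v = ∑ v ∈ N.V, N.b v := by
  conv_rhs => rw [← expand_contract_V ha hA]
  exact sum_contract ha subset_rfl _

/-! ### The extension theorem: hypotheses and reduction at small cuts. -/

/-- The condition on the degree and boundary of a proper vertex set in the extension theorem. -/
def CutOK (d : ℕ) (β : ZMod 3) : Prop := 4 ≤ d ∧ (d = 4 → β = 0) ∧ (d = 5 → β ≠ 0)

/-- The condition on the external vertex in the extension theorem. -/
def RootOK (d : ℕ) (β : ZMod 3) : Prop := d ≤ 5 ∨ (d = 6 ∧ β ≠ 0) ∨ (d = 7 ∧ β = 0)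

lemma CutOK.of_six_le {d : ℕ} {β : ZMod 3} (h : 6 ≤ d) : CutOK d β :=
  ⟨by omega, fun h => by omega, fun h => by omega⟩

/-- Hypotheses of the extension theorem; the set `W` is allowed to violate the cut condition. -/
structure Good (N : Net α ε) (W : Finset α) : Prop where
  wf : N.WF
  sum_b : ∑ v ∈ N.V, N.b v = 0
  root : RootOK (N.deg N.V) (N.bet N.V)
  card_le : W.card ≤ 1
  cut : ∀ A ⊆ N.V, A.Nonempty → A ≠ N.V →
    CutOK (N.deg A) (N.bet A) ∨ (A = W ∧ Even (N.deg A) ∧ N.bet A = 0)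

lemma deg_V {N : Net α ε} (hN : N.WF) : N.deg N.V = ∑ v ∈ N.V, (N.i v + N.j v) := by
  unfold deg
  rw [add_eq_right]
  exact sum_eq_zero fun e he => by simp [cross, hN e he]

lemma bet_V {N : Net α ε} (hb : ∑ v ∈ N.V, N.b v = 0) :
    N.bet N.V = ∑ v ∈ N.V, (N.i v : ZMod 3) - ∑ v ∈ N.V, (N.j v : ZMod 3) := by
  unfold bet
  rw [sum_sub_distrib, sum_add_distrib, hb, zero_add]

lemma size_contract_lt {N : Net α ε} {A : Finset α} {a : α} (ha : a ∈ A) (hA : A ⊆ N.V)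
    (h2 : 2 ≤ A.card) : (N.contract A a).size < N.size := by
  unfold size
  have h1 : ∑ v ∈ (N.contract A a).V, ((N.contract A a).i v + (N.contract A a).j v) =
      ∑ v ∈ N.V, (N.i v + N.j v) := by
    conv_rhs => rw [← expand_contract_V ha hA]
    rw [← sum_contract ha subset_rfl]
    refine sum_congr rfl fun v _ => ?_
    simp only [contract]
    split_ifs <;> simp [sum_add_distrib]
  have h3 : (N.contract A a).V.card < N.V.card := by
    have := card_insert_le a (N.V \ A)
    have h4 := card_sdiff_add_card_eq_card hA
    simp only [contract]
    omega
  rw [h1]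
  simp only [contract] at h3 ⊢
  omega

lemma size_sub_lt {N : Net α ε} {A : Finset α} (f : ε → ZMod 3) (hA : A ⊆ N.V)
    (hAV : A ≠ N.V) : (N.sub A f).size < N.size := by
  have h1 : A.card < N.V.card := card_lt_card (hA.ssubset_of_ne hAV)
  have h2 := sub_deg N f (subset_refl A)
  rw [show (N.sub A f).deg A = _ from deg_V (N.sub_wf A f)] at h2
  have h3 : ∑ e ∈ N.E, cross A (N.s e) (N.t e) + (N.sub A f).E.card ≤ N.E.card := by
    simp only [sub]
    rw [card_filter, ← sum_add_distrib, card_eq_sum_ones]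
    refine sum_le_sum fun e _ => ?_
    unfold cross
    split_ifs <;> first | omega | (exfalso; tauto)
  have h4 : ∑ v ∈ A, (N.i v + N.j v) ≤ ∑ v ∈ N.V, (N.i v + N.j v) :=
    sum_le_sum_of_subset hA
  unfold size
  unfold deg at h2
  have h5 : (N.sub A f).V = A := rfl
  rw [h5] at h2 ⊢
  omega

lemma Good.sub {N : Net α ε} {W A : Finset α} (h : N.Good W) (hA : A ⊆ N.V)
    (hroot : RootOK (N.deg A) (N.bet A)) {f : ε → ZMod 3} (hf : ∀ e ∈ N.E, f e ≠ 0)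
    (hfV : ∀ v ∈ N.V, v ∉ A → N.div f v = N.b v) : (N.sub A f).Good W where
  wf := N.sub_wf A f
  sum_b := sum_sub_b h.wf h.sum_b hA hfV
  root := by
    have h5 : (N.sub A f).V = A := rfl
    rwa [h5, sub_deg N f subset_rfl, N.sub_bet hf]
  card_le := h.card_le
  cut B hB hB0 hBA := by
    rw [sub_deg N f (show B ⊆ A from hB), N.sub_bet hf]
    exact h.cut B (hB.trans hA) hB0 fun h' => hBA (subset_antisymm hB (h' ▸ hA))

lemma Good.contract {N : Net α ε} {W A : Finset α} (h : N.Good W) {a : α} (ha : a ∈ A)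
    (hA : A ⊆ N.V) (h2 : 2 ≤ A.card) : (N.contract A a).Good W where
  wf := contract_wf h.wf A a
  sum_b := (sum_contract_b ha hA).trans h.sum_b
  root := by
    rw [contract_deg N ha (by rfl), contract_bet N ha (by rfl)]
    have : expand A a (N.contract A a).V = N.V := expand_contract_V ha hA
    rw [this]
    exact h.root
  card_le := h.card_le
  cut B hB hB0 hBV := by
    rw [contract_deg N ha hB, contract_bet N ha hB]
    have h1 := h.cut (expand A a B) (expand_subset ha hA hB) ?_ (expand_ne ha hA hB hBV)
    · refine h1.imp_right fun ⟨h3, h4⟩ => ⟨?_, h4⟩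
      -- If `a ∈ B`, then `B` expands to a superset of `A`, which has two vertices and cannot lie in
      -- `W`.
      have h5 : a ∉ B := fun haB => by
        have h6 : A ⊆ W := by
          rw [← h3, expand, if_pos haB]
          exact subset_union_right
        have := card_le_card h6
        have := h.card_le
        omega
      rwa [expand, if_neg h5] at h3
    · obtain ⟨x, hx⟩ := hB0
      refine ⟨x, ?_⟩
      unfold expand
      split_ifs
      exacts [mem_union_left _ hx, hx]

/-- Reduction at a small cut: identify `A`, then extend the solution into `A`. -/
lemma Good.solvable_of_rootOK {N : Net α ε} {W A : Finset α} (h : N.Good W)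
    (IH : ∀ (N' : Net α ε) (W' : Finset α), N'.size < N.size → N'.Good W' → N'.Solvable)
    (hA : A ⊆ N.V) (h2 : 2 ≤ A.card) (hAV : A ≠ N.V) (hroot : RootOK (N.deg A) (N.bet A)) :
    N.Solvable := by
  obtain ⟨a, ha⟩ : A.Nonempty := card_pos.1 (by omega)
  obtain ⟨f, hf, hfV⟩ := IH _ W (size_contract_lt ha hA h2) (h.contract ha hA h2)
  have hfV' : ∀ v ∈ N.V, v ∉ A → N.div f v = N.b v := fun v hv hvA => by
    rw [← contract_div ha f hvA, hfV v (mem_insert_of_mem (mem_sdiff.2 ⟨hv, hvA⟩))]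
    simp only [Net.contract]
    rw [if_neg]
    rintro rfl
    exact hvA ha
  exact solvable_of_sub hf hfV' (IH _ W (size_sub_lt f hA hAV) (h.sub hA hroot hf hfV'))

/-- By parity d > 4 + |τ| means d ≥ 6 + |τ|: the slack of two that lets large sets survive the later
lifts and deletions. -/
lemma of_not_rootOK {d : ℕ} {β : ZMod 3} (h : ¬ RootOK d β) :
    6 ≤ d ∧ (d = 6 → β = 0) ∧ (d = 7 → β ≠ 0) := by
  unfold RootOK at h
  push Not at h
  exact ⟨by omega, fun hd => by simpa [hd] using h.2.1, fun hd => by simpa [hd] using h.2.2⟩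

/-- Reversing all edges. -/
def neg (N : Net α ε) : Net α ε := { N with i := N.j, j := N.i, b := fun v => - N.b v }

lemma neg_deg (N : Net α ε) (A : Finset α) : N.neg.deg A = N.deg A := by
  simp only [deg, neg, add_comm]

lemma neg_bet (N : Net α ε) (A : Finset α) : N.neg.bet A = - N.bet A := by
  simp only [bet, neg, ← sum_neg_distrib]
  exact sum_congr rfl fun v _ => by ring

lemma neg_size (N : Net α ε) : N.neg.size = N.size := by
  simp only [size, neg, add_comm]

lemma neg_div (N : Net α ε) (f : ε → ZMod 3) (v : α) :
    N.div (fun e => - f e) v = - N.div f v := by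
  simp [div, ← sum_neg_distrib]

/-- Reversal symmetry: the cases with external edges leaving and entering are exchanged, so only one
of each pair needs an argument. -/
lemma Solvable.of_neg {N : Net α ε} (h : N.neg.Solvable) : N.Solvable := by
  obtain ⟨f, hf, hfV⟩ := h
  refine ⟨fun e => - f e, fun e he => neg_ne_zero.2 (hf e he), fun v hv => ?_⟩
  rw [neg_div, ← neg_neg (N.b v)]
  exact congrArg _ (hfV v hv)

lemma Good.neg {N : Net α ε} {W : Finset α} (h : N.Good W) : N.neg.Good W where
  wf := h.wf
  sum_b := by simpa [Net.neg] using h.sum_b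
  root := by
    rw [neg_deg, neg_bet]
    simp only [RootOK, neg_ne_zero, neg_eq_zero]
    exact h.root
  card_le := h.card_le
  cut A hA h0 hAV := by
    rw [neg_deg, neg_bet]
    simpa only [CutOK, neg_ne_zero, neg_eq_zero, ne_eq] using h.cut A hA h0 hAV

/-! ### Deleting a directed edge and lifting a pair of edges. -/

variable [DecidableEq ε]

lemma Joins.symm {N : Net α ε} {e : ε} {x y : α} (h : N.Joins e x y) : N.Joins e y x := Or.symm h

lemma Joins.mem {N : Net α ε} (hN : N.WF) {e : ε} (he : e ∈ N.E) {x y : α} (h : N.Joins e x y) :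
    x ∈ N.V ∧ y ∈ N.V := by
  have := hN e he
  rcases h with ⟨rfl, rfl⟩ | ⟨rfl, rfl⟩
  exacts [this, this.symm]

lemma cross_comm (A : Finset α) (x y : α) : cross A x y = cross A y x := by
  simp only [cross, iff_comm]

lemma Joins.cross {N : Net α ε} {e : ε} {x y : α} (h : N.Joins e x y) (A : Finset α) :
    cross A (N.s e) (N.t e) = cross A x y := by
  rcases h with ⟨rfl, rfl⟩ | ⟨rfl, rfl⟩
  exacts [rfl, cross_comm _ _ _]

lemma Joins.exists_sign {N : Net α ε} {e : ε} {x y : α} (h : N.Joins e x y) :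
    ∃ σ : ZMod 3, σ ≠ 0 ∧ ∀ u, σ * ((if N.s e = u then 1 else 0) - (if N.t e = u then 1 else 0)) =
      (if x = u then 1 else 0) - (if y = u then 1 else 0) := by
  rcases h with ⟨rfl, rfl⟩ | ⟨rfl, rfl⟩
  · exact ⟨1, by decide, fun u => by ring⟩
  · exact ⟨-1, by decide, fun u => by ring⟩

/-- Delete the edge `e` after directing it from `y` to `x`, and replace the external edges. -/
def del (N : Net α ε) (e : ε) (y x : α) (i j : α → ℕ) : Net α ε :=
  { N with
    E := N.E.erase e
    b := fun u => N.b u - (if y = u then 1 else 0) + (if x = u then 1 else 0)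
    i := i
    j := j }

lemma solvable_of_del {N : Net α ε} {e : ε} (he : e ∈ N.E) {x y : α} (h : N.Joins e y x)
    {i j : α → ℕ} (hs : (N.del e y x i j).Solvable) : N.Solvable := by
  obtain ⟨f, hf, hfV⟩ := hs
  obtain ⟨σ, hσ, hσ'⟩ := h.exists_sign
  refine ⟨Function.update f e σ, fun e' he' => ?_, fun v hv => ?_⟩
  · by_cases h1 : e' = e
    · subst h1
      simpa using hσ
    · rw [Function.update_of_ne h1]
      exact hf e' (mem_erase.2 ⟨h1, he'⟩)
  · have h1 : ∑ e' ∈ N.E.erase e, f e' * ((if N.s e' = v then 1 else 0) -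
        (if N.t e' = v then 1 else 0)) =
        N.b v - (if y = v then 1 else 0) + (if x = v then 1 else 0) := hfV v hv
    unfold div
    rw [← add_sum_erase _ _ he, Function.update_self, hσ',
      sum_congr rfl fun e' he' => by rw [Function.update_of_ne (ne_of_mem_erase he')], h1]
    ring

lemma del_deg {N : Net α ε} {e : ε} (he : e ∈ N.E) {x y : α} (h : N.Joins e y x)
    (i j : α → ℕ) (A : Finset α) :
    (N.del e y x i j).deg A + cross A y x + ∑ v ∈ A, (N.i v + N.j v) =
      N.deg A + ∑ v ∈ A, (i v + j v) := by
  simp only [deg, del]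
  rw [← add_sum_erase _ _ he, h.cross]
  ring

lemma del_bet (N : Net α ε) (e : ε) (x y : α) (i j : α → ℕ) (A : Finset α) :
    (N.del e y x i j).bet A = N.bet A - (if y ∈ A then 1 else 0) + (if x ∈ A then 1 else 0)
      + ∑ v ∈ A, ((i v : ZMod 3) - j v) - ∑ v ∈ A, ((N.i v : ZMod 3) - N.j v) := by
  simp only [bet, del]
  rw [← sum_ite_eq A y (fun _ => 1), ← sum_ite_eq A x (fun _ => 1), ← sum_sub_distrib,
    ← sum_add_distrib, ← sum_add_distrib, ← sum_sub_distrib]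
  exact sum_congr rfl fun v _ => by ring

lemma del_wf {N : Net α ε} (hN : N.WF) (e : ε) (x y : α) (i j : α → ℕ) :
    (N.del e y x i j).WF := fun e' he' => hN e' (mem_of_mem_erase he')

lemma del_sum_b {N : Net α ε} {x y : α} (hx : x ∈ N.V) (hy : y ∈ N.V) (e : ε) (i j : α → ℕ) :
    ∑ v ∈ (N.del e y x i j).V, (N.del e y x i j).b v = ∑ v ∈ N.V, N.b v := by
  simp only [del]
  rw [sum_add_distrib, sum_sub_distrib, sum_ite_eq, sum_ite_eq, if_pos hx, if_pos hy]
  ring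

lemma del_size {N : Net α ε} {e : ε} (he : e ∈ N.E) (x y : α) (i j : α → ℕ) :
    (N.del e y x i j).size + 4 + ∑ v ∈ N.V, (N.i v + N.j v) =
      N.size + ∑ v ∈ N.V, (i v + j v) := by
  have := card_erase_add_one he
  simp only [size, del]
  omega

/-- Replace the path `x`, `v`, `y` with edges `e₁`, `e₂` by a single edge `e₁` from `x` to `y`. -/
def lift (N : Net α ε) (e₁ e₂ : ε) (x y : α) : Net α ε :=
  { N with
    E := N.E.erase e₂
    s := Function.update N.s e₁ x
    t := Function.update N.t e₁ y }

section lift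

variable {N : Net α ε} {e₁ e₂ : ε} (h₁ : e₁ ∈ N.E) (h₂ : e₂ ∈ N.E) (hne : e₁ ≠ e₂) {x v y : α}
  (hx : N.Joins e₁ x v) (hy : N.Joins e₂ v y)

include h₁ h₂ hne

lemma sum_edges_eq {M : Type*} [AddCommMonoid M] (g : ε → M) :
    ∑ e ∈ N.E, g e = g e₂ + (g e₁ + ∑ e ∈ (N.E.erase e₂).erase e₁, g e) := by
  rw [add_sum_erase _ _ (mem_erase.2 ⟨hne, h₁⟩), add_sum_erase _ _ h₂]

lemma sum_lift_edges_eq {M : Type*} [AddCommMonoid M] (g : ε → M) :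
    ∑ e ∈ (N.lift e₁ e₂ x y).E, g e = g e₁ + ∑ e ∈ (N.E.erase e₂).erase e₁, g e :=
  (add_sum_erase _ _ (mem_erase.2 ⟨hne, h₁⟩)).symm

include hx hy

/-- The value on the new edge is sent along the path `x`, `v`, `y`; the signs `σ` and `τ` account
for the orientations of the two old edges, and the contributions at `v` cancel. -/
lemma solvable_of_lift (hs : (N.lift e₁ e₂ x y).Solvable) : N.Solvable := by
  obtain ⟨f, hf, hfV⟩ := hs
  obtain ⟨σ, hσ, hσ'⟩ := hx.exists_sign
  obtain ⟨τ, hτ, hτ'⟩ := hy.exists_sign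
  have hf1 : f e₁ ≠ 0 := hf e₁ (mem_erase.2 ⟨hne, h₁⟩)
  refine ⟨fun e => if e = e₁ then f e₁ * σ else if e = e₂ then f e₁ * τ else f e,
    fun e he => ?_, fun u hu => ?_⟩
  · dsimp only
    split_ifs with h3 h4
    exacts [mul_ne_zero hf1 hσ, mul_ne_zero hf1 hτ, hf e (mem_erase.2 ⟨h4, he⟩)]
  · have h5 := hfV u hu
    unfold div at h5 ⊢
    rw [sum_lift_edges_eq h₁ h₂ hne] at h5
    rw [sum_edges_eq h₁ h₂ hne]
    beta_reduce
    rw [if_pos rfl, if_neg hne.symm, if_pos rfl, mul_assoc, mul_assoc, hσ', hτ']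
    have h6 : ∀ e ∈ (N.E.erase e₂).erase e₁, (if e = e₁ then f e₁ * σ else if e = e₂ then f e₁ * τ
        else f e) * ((if N.s e = u then 1 else 0) - (if N.t e = u then 1 else 0)) = f e *
        ((if (N.lift e₁ e₂ x y).s e = u then 1 else 0)
          - (if (N.lift e₁ e₂ x y).t e = u then 1 else 0)) := by
      intro e he
      rw [if_neg (ne_of_mem_erase he), if_neg (ne_of_mem_erase (mem_of_mem_erase he))]
      have hs : (N.lift e₁ e₂ x y).s e = N.s e := Function.update_of_ne (ne_of_mem_erase he) _ _
      have ht : (N.lift e₁ e₂ x y).t e = N.t e := Function.update_of_ne (ne_of_mem_erase he) _ _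
      rw [hs, ht]
    rw [sum_congr rfl h6]
    have h7 : (N.lift e₁ e₂ x y).b u = N.b u := rfl
    rw [← h7, ← h5]
    have hs : (N.lift e₁ e₂ x y).s e₁ = x := Function.update_self _ _ _
    have ht : (N.lift e₁ e₂ x y).t e₁ = y := Function.update_self _ _ _
    rw [hs, ht]
    ring

lemma lift_deg (A : Finset α) : (N.lift e₁ e₂ x y).deg A + (cross A x v + cross A v y) =
    N.deg A + cross A x y := by
  unfold deg
  rw [sum_lift_edges_eq h₁ h₂ hne, sum_edges_eq h₁ h₂ hne, hx.cross, hy.cross]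
  have h6 : ∀ e ∈ (N.E.erase e₂).erase e₁,
      cross A ((N.lift e₁ e₂ x y).s e) ((N.lift e₁ e₂ x y).t e) = cross A (N.s e) (N.t e) := by
    intro e he
    simp only [lift]
    rw [Function.update_of_ne (ne_of_mem_erase he), Function.update_of_ne (ne_of_mem_erase he)]
  rw [sum_congr rfl h6]
  simp only [lift, Function.update_self]
  ring

lemma lift_wf (hN : N.WF) : (N.lift e₁ e₂ x y).WF := by
  intro e he
  simp only [lift] at he ⊢
  by_cases h3 : e = e₁
  · subst h3
    simp only [Function.update_self]
    exact ⟨(hx.mem hN h₁).1, (hy.mem hN h₂).2⟩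
  · rw [Function.update_of_ne h3, Function.update_of_ne h3]
    exact hN e (mem_of_mem_erase he)

end lift

lemma lift_size_lt {N : Net α ε} {e₁ e₂ : ε} (h₂ : e₂ ∈ N.E) (x y : α) :
    (N.lift e₁ e₂ x y).size < N.size := by
  have := card_erase_add_one h₂
  simp only [size, lift]
  omega

/-- Parallel edges between two vertices, even in number, can be directed in a balanced way. -/
lemma exists_ne_zero_sum_eq_zero (K : Finset ε) (hK : Even K.card) :
    ∃ g : ε → ZMod 3, (∀ e, g e ≠ 0) ∧ ∑ e ∈ K, g e = 0 := by
  obtain ⟨k, hk⟩ := hK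
  obtain ⟨L, hL, hLk⟩ := exists_subset_card_eq (show k ≤ K.card by omega)
  refine ⟨fun e => if e ∈ L then 1 else -1, fun e => ?_, ?_⟩
  · dsimp only
    split_ifs <;> decide
  · have h1 := card_sdiff_add_card_eq_card hL
    have h2 : (K \ L).card = k := by omega
    rw [← sum_sdiff hL, sum_congr rfl fun e he => if_neg (mem_sdiff.1 he).2,
      sum_congr rfl fun e he => if_pos he]
    simp [h2, hLk]

lemma bet_singleton (N : Net α ε) (v : α) : N.bet {v} = N.b v + N.i v - N.j v := by
  simp [bet]

lemma deg_singleton (N : Net α ε) (v : α) :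
    N.deg {v} = ∑ e ∈ N.E, cross {v} (N.s e) (N.t e) + (N.i v + N.j v) := by
  simp [deg]

lemma deg_add_deg_sdiff {N : Net α ε} (hN : N.WF) {S : Finset α} (hS : S ⊆ N.V)
    (h : ∀ e ∈ N.E, (N.s e ∈ S ↔ N.t e ∈ S)) : N.deg S + N.deg (N.V \ S) = N.deg N.V := by
  rw [deg_V hN, ← sum_sdiff hS]
  have h1 : ∑ e ∈ N.E, cross S (N.s e) (N.t e) = 0 :=
    sum_eq_zero fun e he => by simp [cross, h e he]
  have h2 : ∑ e ∈ N.E, cross (N.V \ S) (N.s e) (N.t e) = 0 :=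
    sum_eq_zero fun e he => by simp [cross, h e he, hN e he]
  unfold deg
  omega

/-! ### Vertices of even degree and zero boundary. -/

open Classical in
/-- If all edges at `v` join it to `x`, then a flow of the graph with `v`, `x` identified
extends. -/
lemma Good.solvable_of_parallel {N : Net α ε} {W : Finset α} (h : N.Good W) {v x : α}
    (hv : v ∈ N.V) (hx : x ∈ N.V) (hvx : v ≠ x)
    (hpar : ∀ e ∈ N.E, ∀ y, y ≠ v → N.Joins e v y → y = x) (hi : N.i v = 0) (hj : N.j v = 0)
    (heven : Even (N.deg {v})) (hbet : N.bet {v} = 0)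
    (IH : ∀ (N' : Net α ε) (W' : Finset α), N'.size < N.size → N'.Good W' → N'.Solvable) :
    N.Solvable := by
  have hA : {v, x} ⊆ N.V := by simp [insert_subset_iff, hv, hx]
  have hxA : x ∈ ({v, x} : Finset α) := by simp
  have h2 : 2 ≤ ({v, x} : Finset α).card := (card_pair hvx).ge
  obtain ⟨f₁, hf₁, hfV₁⟩ := IH _ W (size_contract_lt hxA hA h2) (h.contract hxA hA h2)
  have hb : N.b v = 0 := by simpa [bet_singleton, hi, hj] using hbet
  have hends : ∀ e ∈ N.E, ¬ N.Joins e v x → (N.s e = v ↔ N.t e = v) := by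
    intro e he hn
    by_contra hc
    by_cases hs : N.s e = v
    · have ht : N.t e ≠ v := by tauto
      have := hpar e he (N.t e) ht (Or.inl ⟨hs, rfl⟩)
      exact hn (Or.inl ⟨hs, this⟩)
    · have ht : N.t e = v := by tauto
      have := hpar e he (N.s e) hs (Or.inr ⟨rfl, ht⟩)
      exact hn (Or.inr ⟨this, ht⟩)
  have hK : Even (N.E.filter fun e => N.Joins e v x).card := by
    rw [deg_singleton, hi, hj, add_zero, add_zero] at heven
    rw [card_filter]
    convert heven using 1
    refine sum_congr rfl fun e he => ?_
    split_ifs with hJ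
    · rw [hJ.cross]
      simp [cross, hvx.symm]
    · have := hends e he hJ
      simp [cross, this]
  obtain ⟨g, hg, hgK⟩ := exists_ne_zero_sum_eq_zero _ hK
  -- The edges between `v` and `x` are loops after contraction, so their values are free; they are
  -- chosen to balance `v`, and `x` follows.
  refine solvable_of_forall_ne h.wf h.sum_b x
    (fun e => if N.Joins e v x then (if N.s e = v then g e else - g e) else f₁ e) ?_ ?_
  · intro e he
    split_ifs
    exacts [hg e, neg_ne_zero.2 (hg e), hf₁ e he]
  · intro u hu hux
    by_cases huv : u = v
    · subst huv
      rw [hb, ← hgK, sum_filter]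
      refine sum_congr rfl fun e he => ?_
      beta_reduce
      split_ifs with hJ <;> first | rfl | (have := hends e he; simp_all [Joins])
    · have huA : u ∉ ({v, x} : Finset α) := by simp [huv, hux]
      have h3 := hfV₁ u (mem_insert_of_mem (mem_sdiff.2 ⟨hu, huA⟩))
      rw [contract_div hxA _ huA] at h3
      have h4 : (N.contract {v, x} x).b u = N.b u := by simp [Net.contract, hux]
      rw [← h4, ← h3]
      refine sum_congr rfl fun e he => ?_
      by_cases hJ : N.Joins e v x
      · have h5 : N.s e ≠ u ∧ N.t e ≠ u := by
          rcases hJ with ⟨h3, h4⟩ | ⟨h3, h4⟩ <;> rw [h3, h4] <;>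
            simp [Ne.symm huv, Ne.symm hux]
        rw [if_neg h5.1, if_neg h5.2, sub_self, mul_zero, mul_zero]
      · beta_reduce
        rw [if_neg hJ]

/-- The new edge keeps the degrees of `x` and `y` because `x ≠ y`. Only `v` loses degree, by two,
and it is the exceptional vertex; a large set loses at most two, which `hbig` allows. -/
lemma Good.solvable_of_lift {N : Net α ε} {v x y : α} (h : N.Good {v}) {e₁ e₂ : ε}
    (h₁ : e₁ ∈ N.E) (h₂ : e₂ ∈ N.E) (hne : e₁ ≠ e₂) (hJ₁ : N.Joins e₁ x v)
    (hJ₂ : N.Joins e₂ v y) (hxv : x ≠ v) (hyv : y ≠ v) (hxy : x ≠ y)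
    (heven : Even (N.deg {v})) (hbet : N.bet {v} = 0)
    (hbig : ∀ A ⊆ N.V, 2 ≤ A.card → A ≠ N.V → ¬ RootOK (N.deg A) (N.bet A))
    (IH : ∀ (N' : Net α ε) (W' : Finset α), N'.size < N.size → N'.Good W' → N'.Solvable) :
    N.Solvable := by
  refine Net.solvable_of_lift h₁ h₂ hne hJ₁ hJ₂ (IH _ {v} (lift_size_lt h₂ x y) ?_)
  have hd := lift_deg h₁ h₂ hne hJ₁ hJ₂
  have hb : ∀ A, (N.lift e₁ e₂ x y).bet A = N.bet A := fun A => rfl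
  refine ⟨lift_wf h₁ h₂ hne hJ₁ hJ₂ h.wf, h.sum_b, ?_, h.card_le, ?_⟩
  · have hV : (N.lift e₁ e₂ x y).V = N.V := rfl
    have := hd N.V
    rw [hb, hV]
    simp only [cross, hJ₁.mem h.wf h₁, hJ₂.mem h.wf h₂] at this
    simp at this
    rw [this]
    exact h.root
  · intro A hA hA0 hAV
    rw [hb]
    have hdA := hd A
    rcases Nat.lt_or_ge A.card 2 with h3 | h3
    · obtain ⟨u, rfl⟩ := card_eq_one.1 (show A.card = 1 by have := hA0.card_pos; omega)
      by_cases huv : u = v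
      · subst huv
        refine Or.inr ⟨rfl, ?_, hbet⟩
        simp only [cross, mem_singleton, hxv, hyv] at hdA
        simp at hdA
        rw [← hdA] at heven
        simpa [Nat.even_add] using heven
      · left
        have h4 := (h.cut {u} hA hA0 hAV).resolve_right fun h5 => huv (by simpa using h5.1)
        convert h4 using 1
        simp only [cross, mem_singleton] at hdA
        have : ¬ (x = u ∧ y = u) := fun h => hxy (h.1.trans h.2.symm)
        by_cases hxu : x = u <;> by_cases hyu : y = u <;> simp_all <;> grind
    · left
      obtain ⟨h4, h5, h6⟩ := of_not_rootOK (hbig A hA h3 hAV)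
      have h7 : (N.lift e₁ e₂ x y).deg A = N.deg A ∨ (N.lift e₁ e₂ x y).deg A + 2 = N.deg A := by
        unfold cross at hdA
        by_cases hxA : x ∈ A <;> by_cases hvA : v ∈ A <;> by_cases hyA : y ∈ A <;>
          simp [hxA, hvA, hyA] at hdA <;> omega
      rcases h7 with h7 | h7
      · rw [h7]
        exact CutOK.of_six_le h4
      · exact ⟨by omega, fun _ => h5 (by omega), fun _ => h6 (by omega)⟩

/-- Lifting an internal edge at `v` together with an external one: the external edge leaving `v` is
moved to `x`, so the root keeps its degree and boundary. -/
lemma Good.solvable_of_lift_external {N : Net α ε} {v x : α} (h : N.Good {v}) {e : ε}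
    (he : e ∈ N.E) (hJ : N.Joins e x v) (hxv : x ≠ v) (hi : 1 ≤ N.i v)
    (heven : Even (N.deg {v})) (hbet : N.bet {v} = 0)
    (hbig : ∀ A ⊆ N.V, 2 ≤ A.card → A ≠ N.V → ¬ RootOK (N.deg A) (N.bet A))
    (IH : ∀ (N' : Net α ε) (W' : Finset α), N'.size < N.size → N'.Good W' → N'.Solvable) :
    N.Solvable := by
  obtain ⟨hxV, hvV⟩ := hJ.mem h.wf he
  set i' : α → ℕ := fun u => N.i u + (if x = u then 1 else 0) - (if v = u then 1 else 0) with hi'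
  have hi'' : ∀ u, i' u + (if v = u then 1 else 0) = N.i u + (if x = u then 1 else 0) := by
    intro u
    simp only [hi']
    by_cases hvu : v = u
    · subst hvu
      simp [hxv]
      omega
    · simp [hvu]
  have hsum : ∀ A : Finset α, ∑ u ∈ A, i' u + (if v ∈ A then 1 else 0) =
      ∑ u ∈ A, N.i u + (if x ∈ A then 1 else 0) := by
    intro A
    rw [← sum_ite_eq A v (fun _ => 1), ← sum_ite_eq A x (fun _ => 1), ← sum_add_distrib,
      ← sum_add_distrib, sum_congr rfl fun u _ => hi'' u]
  have hd := del_deg he hJ i' N.j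
  have hb : ∀ A, (N.del e x v i' N.j).bet A = N.bet A := fun A => by
    have := congrArg (Nat.cast : ℕ → ZMod 3) (hsum A)
    push_cast at this
    rw [del_bet, sum_sub_distrib, sum_sub_distrib]
    linear_combination this
  have hd' : ∀ A, (N.del e x v i' N.j).deg A + cross A x v + (if v ∈ A then 1 else 0) =
      N.deg A + (if x ∈ A then 1 else 0) := fun A => by
    have h1 := hd A
    have h2 := hsum A
    rw [sum_add_distrib, sum_add_distrib] at h1
    omega
  refine Net.solvable_of_del he hJ (i := i') (j := N.j) (IH _ {v} ?_ ?_)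
  · have h1 := del_size he v x i' N.j
    have h2 := hsum N.V
    rw [sum_add_distrib, sum_add_distrib] at h1
    rw [if_pos hxV, if_pos hvV] at h2
    omega
  refine ⟨del_wf h.wf _ _ _ _ _, (del_sum_b hvV hxV e i' N.j).trans h.sum_b, ?_, h.card_le, ?_⟩
  · have hV : (N.del e x v i' N.j).V = N.V := rfl
    have := hd' N.V
    rw [hb, hV]
    simp only [cross, hxV, hvV] at this
    simp at this
    rw [this]
    exact h.root
  · intro A hA hA0 hAV
    rw [hb]
    have hdA := hd' A
    rcases Nat.lt_or_ge A.card 2 with h3 | h3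
    · obtain ⟨u, rfl⟩ := card_eq_one.1 (show A.card = 1 by have := hA0.card_pos; omega)
      by_cases huv : u = v
      · subst huv
        refine Or.inr ⟨rfl, ?_, hbet⟩
        simp [cross, hxv] at hdA
        rw [← hdA] at heven
        simpa [Nat.even_add, add_assoc] using heven
      · left
        have h4 := (h.cut {u} hA hA0 hAV).resolve_right fun h5 => huv (by simpa using h5.1)
        convert h4 using 1
        simp only [cross, mem_singleton] at hdA
        by_cases hxu : x = u <;> simp_all <;> grind
    · left
      obtain ⟨h4, h5, h6⟩ := of_not_rootOK (hbig A hA h3 hAV)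
      have h7 : (N.del e x v i' N.j).deg A = N.deg A ∨
          (N.del e x v i' N.j).deg A + 2 = N.deg A := by
        unfold cross at hdA
        by_cases hxA : x ∈ A <;> by_cases hvA : v ∈ A <;>
          simp [hxA, hvA] at hdA <;> omega
      rcases h7 with h7 | h7
      · rw [h7]
        exact CutOK.of_six_le h4
      · exact ⟨by omega, fun _ => h5 (by omega), fun _ => h6 (by omega)⟩

/-- The case of a vertex of even degree at which the boundary is zero. -/
lemma Good.solvable_of_even {N : Net α ε} {v : α} (h : N.Good {v}) (hv : v ∈ N.V)
    (hcard : 2 ≤ N.V.card) (heven : Even (N.deg {v})) (hbet : N.bet {v} = 0)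
    (hbig : ∀ A ⊆ N.V, 2 ≤ A.card → A ≠ N.V → ¬ RootOK (N.deg A) (N.bet A))
    (IH : ∀ (N' : Net α ε) (W' : Finset α), N'.size < N.size → N'.Good W' → N'.Solvable) :
    N.Solvable := by
  by_cases hx : ∃ e₁ ∈ N.E, ∃ x, x ≠ v ∧ N.Joins e₁ x v
  · obtain ⟨e₁, h₁, x, hxv, hJ₁⟩ := hx
    by_cases hy : ∃ e₂ ∈ N.E, ∃ y, y ≠ v ∧ y ≠ x ∧ N.Joins e₂ v y
    · obtain ⟨e₂, h₂, y, hyv, hyx, hJ₂⟩ := hy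
      refine h.solvable_of_lift h₁ h₂ ?_ hJ₁ hJ₂ hxv hyv hyx.symm heven hbet hbig IH
      rintro rfl
      unfold Joins at hJ₁ hJ₂
      grind
    · rcases Nat.eq_zero_or_pos (N.i v) with hi | hi
      · rcases Nat.eq_zero_or_pos (N.j v) with hj | hj
        · refine h.solvable_of_parallel hv (hJ₁.mem h.wf h₁).1 hxv.symm ?_ hi hj heven hbet IH
          intro e he y hyv hJ
          by_contra hyx
          exact hy ⟨e, he, y, hyv, hyx, hJ⟩
        · refine Solvable.of_neg (h.neg.solvable_of_lift_external h₁ hJ₁ hxv hj ?_ ?_ ?_ ?_)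
          · rwa [neg_deg]
          · rw [neg_bet, hbet, neg_zero]
          · intro A hA h2 hAV
            rw [neg_deg, neg_bet]
            simpa only [RootOK, ne_eq, neg_eq_zero] using hbig A hA h2 hAV
          · rwa [neg_size]
      · exact h.solvable_of_lift_external h₁ hJ₁ hxv hi heven hbet hbig IH
  · obtain ⟨x, hxV, hxv⟩ : ∃ x ∈ N.V, x ≠ v := exists_mem_ne (by omega) v
    have hnot : ∀ e ∈ N.E, ∀ y, y ≠ v → ¬ N.Joins e v y := fun e he y hy hJ =>
      hx ⟨e, he, y, hy, hJ.symm⟩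
    have hst : ∀ e ∈ N.E, (N.s e = v ↔ N.t e = v) := by
      intro e he
      by_contra hc
      by_cases hs : N.s e = v
      · exact hnot e he (N.t e) (by tauto) (Or.inl ⟨hs, rfl⟩)
      · exact hnot e he (N.s e) hs (Or.inr ⟨rfl, by tauto⟩)
    -- No internal edge leaves `v`, so `V` and `V \ {v}` have the same boundary, and degrees of the
    -- same parity. With the same |τ|, the cut condition and the root condition leave no external
    -- edge at `v`.
    have h0 : N.i v + N.j v = 0 := by
      have hdv : N.deg {v} = N.i v + N.j v := by
        rw [deg_singleton, add_eq_right]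
        exact sum_eq_zero fun e he => by simp [cross, hst e he]
      have h1 : N.deg (N.V.erase v) + (N.i v + N.j v) = N.deg N.V := by
        rw [← hdv, add_comm, ← sdiff_singleton_eq_erase]
        exact deg_add_deg_sdiff h.wf (by simpa) (by simpa using hst)
      have h2 : N.bet (N.V.erase v) = N.bet N.V := by
        have : N.bet N.V = N.bet (N.V.erase v) + N.bet {v} := by
          simp only [bet, sum_singleton]
          exact (sum_erase_add _ _ hv).symm
        rw [this, hbet, add_zero]
      have h3 := (h.cut (N.V.erase v) (erase_subset _ _) ⟨x, mem_erase.2 ⟨hxv, hxV⟩⟩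
        (erase_ne_self.2 hv)).resolve_right fun h => by
          have := h.1 ▸ mem_singleton_self v
          simp at this
      have h4 := h.root
      rw [hdv] at heven
      rw [← h1, ← h2] at h4
      obtain ⟨k, hk⟩ := heven
      unfold RootOK at h4
      obtain ⟨h5, h6, h7⟩ := h3
      by_contra hne
      rcases h4 with h4 | ⟨h4, h8⟩ | ⟨h4, h8⟩
      · omega
      · exact h8 (h6 (by omega))
      · exact h7 (by omega) h8
    refine h.solvable_of_parallel hv hxV hxv.symm (fun e he y hy hJ => (hnot e he y hy hJ).elim)
      (by omega) (by omega) heven hbet IH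

/-! ### Deletions when no vertex has even degree and zero boundary. -/

lemma CutOK.neg {d : ℕ} {β : ZMod 3} (h : CutOK d β) : CutOK d (-β) := by
  simpa only [CutOK, ne_eq, neg_eq_zero] using h

/-- Deleting the edge `e` after directing it from `y` to `x`, and adding `k` external edges at `x`
that do not change the boundary modulo 3. -/
lemma Good.solvable_of_del {N : Net α ε} {W : Finset α} (h : N.Good W)
    (hcut : ∀ A ⊆ N.V, A.Nonempty → A ≠ N.V → CutOK (N.deg A) (N.bet A))
    (hbig : ∀ A ⊆ N.V, 2 ≤ A.card → A ≠ N.V → ¬ RootOK (N.deg A) (N.bet A))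
    {e : ε} (he : e ∈ N.E) {x y : α} (hJ : N.Joins e y x) (hyx : y ≠ x) {k : ℕ} (hk : k ≤ 3)
    {i j : α → ℕ} (hij : ∀ u, i u + j u = N.i u + N.j u + (if x = u then k else 0))
    (hij' : ∀ u, (i u : ZMod 3) - j u = N.i u - N.j u)
    (hroot : RootOK (N.deg N.V + k) (N.bet N.V))
    (hx : CutOK (N.deg {x} - 1 + k) (N.bet {x} + 1)) (hy : CutOK (N.deg {y} - 1) (N.bet {y} - 1))
    (IH : ∀ (N' : Net α ε) (W' : Finset α), N'.size < N.size → N'.Good W' → N'.Solvable) :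
    N.Solvable := by
  obtain ⟨hyV, hxV⟩ := hJ.mem h.wf he
  have hsum : ∀ A : Finset α, ∑ u ∈ A, (i u + j u) =
      ∑ u ∈ A, (N.i u + N.j u) + (if x ∈ A then k else 0) := by
    intro A
    rw [← sum_ite_eq A x (fun _ => k), ← sum_add_distrib, sum_congr rfl fun u _ => hij u]
  have hd : ∀ A, (N.del e y x i j).deg A + cross A y x = N.deg A + (if x ∈ A then k else 0) := by
    intro A
    have h1 := del_deg he hJ i j A
    have h2 := hsum A
    omega
  have hb : ∀ A, (N.del e y x i j).bet A =
      N.bet A - (if y ∈ A then 1 else 0) + (if x ∈ A then 1 else 0) := by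
    intro A
    rw [del_bet, sum_congr rfl fun u _ => hij' u]
    ring
  refine Net.solvable_of_del he hJ (i := i) (j := j) (IH _ W ?_ ?_)
  · have h1 := del_size he x y i j
    have h2 := hsum N.V
    rw [if_pos hxV] at h2
    omega
  refine ⟨del_wf h.wf _ _ _ _ _, (del_sum_b hxV hyV e i j).trans h.sum_b, ?_, h.card_le, ?_⟩
  · have hV : (N.del e y x i j).V = N.V := rfl
    have h1 := hd N.V
    have h2 := hb N.V
    simp only [cross, hxV, hyV, if_true] at h1 h2
    rw [sub_add_cancel] at h2
    rw [hV, h2]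
    convert hroot using 1
    exact h1
  · intro A hA hA0 hAV
    left
    have hdA := hd A
    rw [hb]
    rcases Nat.lt_or_ge A.card 2 with h3 | h3
    · obtain ⟨u, rfl⟩ := card_eq_one.1 (show A.card = 1 by have := hA0.card_pos; omega)
      have h0 := hcut _ hA hA0 hAV
      simp only [cross, mem_singleton] at hdA ⊢
      by_cases hyu : y = u
      · subst hyu
        simp only [hyx.symm] at hdA ⊢
        simp at hdA ⊢
        have : (N.del e y x i j).deg {y} = N.deg {y} - 1 := by omega
        rwa [this]
      · by_cases hxu : x = u
        · subst hxu
          simp only [hyx] at hdA ⊢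
          simp at hdA ⊢
          have : (N.del e y x i j).deg {x} = N.deg {x} - 1 + k := by
            have := h0.1
            omega
          rwa [this]
        · simp [hyu, hxu] at hdA ⊢
          rwa [hdA]
    · obtain ⟨h4, h5, h6⟩ := of_not_rootOK (hbig A hA h3 hAV)
      unfold cross at hdA
      by_cases hyA : y ∈ A <;> by_cases hxA : x ∈ A <;> simp [hyA, hxA] at hdA ⊢
      · exact CutOK.of_six_le (by omega)
      · refine ⟨by omega, by omega, fun h7 => ?_⟩
        rw [h5 (by omega)]
        decide
      · refine ⟨by omega, by omega, fun h7 => ?_⟩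
        rw [h5 (by omega)]
        decide
      · exact CutOK.of_six_le (by omega)

/-- Deleting an external edge entering `x`. -/
lemma Good.solvable_of_del_external {N : Net α ε} {W : Finset α} (h : N.Good W)
    (hcut : ∀ A ⊆ N.V, A.Nonempty → A ≠ N.V → CutOK (N.deg A) (N.bet A))
    (hbig : ∀ A ⊆ N.V, 2 ≤ A.card → A ≠ N.V → ¬ RootOK (N.deg A) (N.bet A))
    {x : α} (hxV : x ∈ N.V) (hj : 1 ≤ N.j x) (hx : CutOK (N.deg {x} - 1) (N.bet {x} + 1))
    (IH : ∀ (N' : Net α ε) (W' : Finset α), N'.size < N.size → N'.Good W' → N'.Solvable) :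
    N.Solvable := by
  set j : α → ℕ := fun u => N.j u - (if x = u then 1 else 0) with hjdef
  have hj' : ∀ u, j u + (if x = u then 1 else 0) = N.j u := by
    intro u
    simp only [hjdef]
    by_cases hxu : x = u
    · subst hxu
      simp
      omega
    · simp [hxu]
  have hsum : ∀ A : Finset α, ∑ u ∈ A, j u + (if x ∈ A then 1 else 0) = ∑ u ∈ A, N.j u := by
    intro A
    rw [← sum_ite_eq A x (fun _ => 1), ← sum_add_distrib, sum_congr rfl fun u _ => hj' u]
  set N' : Net α ε := { N with j := j } with hN'
  have hd : ∀ A, N'.deg A + (if x ∈ A then 1 else 0) = N.deg A := by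
    intro A
    have := hsum A
    simp only [deg, hN', sum_add_distrib]
    omega
  have hb : ∀ A, N'.bet A = N.bet A + (if x ∈ A then 1 else 0) := by
    intro A
    have := congrArg (Nat.cast : ℕ → ZMod 3) (hsum A)
    push_cast at this
    simp only [bet, hN', sum_add_distrib, sum_sub_distrib]
    linear_combination -this
  have hs : N'.size < N.size := by
    have := hsum N.V
    rw [if_pos hxV] at this
    simp only [size, hN', sum_add_distrib]
    omega
  -- `N'` differs from `N` only in `j`, so the two solvability statements coincide.
  refine show N'.Solvable from IH N' W hs ⟨h.wf, h.sum_b, ?_, h.card_le, ?_⟩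
  · have h1 := hd N.V
    have h2 := hb N.V
    rw [if_pos hxV] at h1 h2
    have h3 := h.root
    change RootOK (N'.deg N.V) (N'.bet N.V)
    rw [h2]
    unfold RootOK at h3 ⊢
    rw [← h1] at h3
    rcases h3 with h3 | ⟨h3, h4⟩ | ⟨h3, h4⟩
    · left; omega
    · left; omega
    · right; left
      refine ⟨by omega, ?_⟩
      rw [h4]
      decide
  · intro A hA hA0 hAV
    left
    have hdA := hd A
    rw [hb]
    rcases Nat.lt_or_ge A.card 2 with h3 | h3
    · obtain ⟨u, rfl⟩ := card_eq_one.1 (show A.card = 1 by have := hA0.card_pos; omega)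
      have h0 := hcut _ hA hA0 hAV
      by_cases hxu : x = u
      · subst hxu
        simp at hdA ⊢
        have : N'.deg {x} = N.deg {x} - 1 := by omega
        rwa [this]
      · simp [hxu] at hdA ⊢
        rwa [hdA]
    · obtain ⟨h4, h5, h6⟩ := of_not_rootOK (hbig A hA h3 hAV)
      split_ifs at hdA ⊢
      · refine ⟨by omega, by omega, fun h7 => ?_⟩
        rw [h5 (by omega)]
        decide
      · exact CutOK.of_six_le (by omega)

/-- The case where every vertex has a demand that lets it lose an outgoing edge, but not an
incoming one. -/
lemma Good.solvable_of_pos {N : Net α ε} {W : Finset α} (h : N.Good W)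
    (hcut : ∀ A ⊆ N.V, A.Nonempty → A ≠ N.V → CutOK (N.deg A) (N.bet A))
    (hbig : ∀ A ⊆ N.V, 2 ≤ A.card → A ≠ N.V → ¬ RootOK (N.deg A) (N.bet A))
    (hedge : ∀ x ∈ N.V, ∃ e ∈ N.E, ∃ y, y ≠ x ∧ N.Joins e y x)
    (h5 : ∀ x ∈ N.V, 5 ≤ N.deg {x})
    (hpos : ∀ x ∈ N.V, CutOK (N.deg {x} - 1) (N.bet {x} - 1))
    (hneg : ∀ x ∈ N.V, ¬ CutOK (N.deg {x} - 1) (N.bet {x} + 1))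
    (hi : ∀ x ∈ N.V, N.i x = 0) (hV : N.V.Nonempty)
    (IH : ∀ (N' : Net α ε) (W' : Finset α), N'.size < N.size → N'.Good W' → N'.Solvable) :
    N.Solvable := by
  by_cases hj : ∃ x ∈ N.V, 1 ≤ N.j x
  · obtain ⟨x, hx, hjx⟩ := hj
    obtain ⟨e, he, y, hyx, hJ⟩ := hedge x hx
    -- One external edge into `x` is replaced by two out of `x`: the boundary changes by 3 = 0, and
    -- the extra edge compensates the loss of `e` at `x`.
    refine h.solvable_of_del hcut hbig he hJ hyx (k := 1) (by norm_num)
      (i := fun u => N.i u + (if x = u then 2 else 0))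
      (j := fun u => N.j u - (if x = u then 1 else 0)) ?_ ?_ ?_ ?_ (hpos y (hJ.mem h.wf he).1) IH
    · intro u
      split_ifs with hxu
      · subst hxu
        omega
      · omega
    · intro u
      by_cases hxu : x = u
      · subst hxu
        simp only [if_true]
        rw [Nat.cast_sub hjx]
        push_cast
        have : (3 : ZMod 3) = 0 := by decide
        linear_combination this
      · simp [hxu]
    · have h1 : N.deg N.V = ∑ u ∈ N.V, N.j u := by
        rw [deg_V h.wf]
        exact sum_congr rfl fun u hu => by rw [hi u hu, zero_add]
      -- All external edges enter, so the root has β = -d. Then `RootOK` excludes d = 6 and d = 7,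
      -- and one more external edge is affordable.
      have h2 : N.bet N.V = - (N.deg N.V : ℕ) := by
        rw [h1, bet_V h.sum_b, sum_eq_zero fun u hu => by rw [hi u hu, Nat.cast_zero]]
        push_cast
        ring
      have h3 := h.root
      rw [h2] at h3 ⊢
      generalize N.deg N.V = d at h3
      unfold RootOK at h3 ⊢
      have h4 : d ≤ 7 := by omega
      clear * - h3 h4
      revert h3
      interval_cases d <;> decide
    · have h1 := h5 x hx
      have h2 := hpos x hx
      have h3 := hneg x hx
      rw [Nat.sub_add_cancel (by omega)]
      have h4 : N.deg {x} ≤ 6 := by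
        by_contra h4
        exact h3 (CutOK.of_six_le (by omega))
      refine ⟨by omega, by omega, fun h6 h7 => ?_⟩
      have h8 := h2.2.1 (by omega)
      exact absurd (sub_eq_zero.1 h8 ▸ h7) (by decide)
  · push Not at hj
    obtain ⟨x, hx⟩ := hV
    obtain ⟨e, he, y, hyx, hJ⟩ := hedge x hx
    -- With no external edges at all, three new ones may enter `x`; the root then has degree 3, and
    -- `x` has degree at least 7.
    refine h.solvable_of_del hcut hbig he hJ hyx (k := 3) (by norm_num)
      (i := N.i) (j := fun u => N.j u + (if x = u then 3 else 0)) ?_ ?_ ?_ ?_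
      (hpos y (hJ.mem h.wf he).1) IH
    · intro u
      ring
    · intro u
      have : (3 : ZMod 3) = 0 := by decide
      split_ifs <;> simp [this]
    · left
      rw [deg_V h.wf, sum_eq_zero fun u hu => by have := hj u hu; rw [hi u hu]; omega]
      norm_num
    · have := h5 x hx
      exact CutOK.of_six_le (by omega)

lemma solvable_of_card_lt_two {N : Net α ε} (hN : N.WF) (hb : ∑ v ∈ N.V, N.b v = 0)
    (hcard : N.V.card < 2) : N.Solvable := by
  refine ⟨1, fun e _ => one_ne_zero, fun v hv => ?_⟩
  have hV : N.V = {v} := by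
    obtain ⟨u, hu⟩ := card_eq_one.1 (show N.V.card = 1 by
      have := card_pos.2 ⟨v, hv⟩
      omega)
    rw [hu, mem_singleton] at hv
    rw [hu, hv]
  have h2 := sum_div_self hN 1
  rw [hV, sum_singleton] at hb h2
  rw [hb, h2]

/-- The extension theorem of Lovász, Thomassen, Wu and Zhang for flows modulo 3. -/
theorem Good.solvable (N : Net α ε) (W : Finset α) (h : N.Good W) : N.Solvable := by
  induction hn : N.size using Nat.strong_induction_on generalizing N W with
  | _ n IH₀ =>
  have IH : ∀ (N' : Net α ε) (W' : Finset α), N'.size < N.size → N'.Good W' → N'.Solvable :=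
    fun N' W' hs hg => IH₀ _ (hn ▸ hs) N' W' hg rfl
  clear IH₀
  rcases Nat.lt_or_ge N.V.card 2 with hcard | hcard
  · exact solvable_of_card_lt_two h.wf h.sum_b hcard
  by_cases hbig : ∀ A ⊆ N.V, 2 ≤ A.card → A ≠ N.V → ¬ RootOK (N.deg A) (N.bet A)
  swap
  · push Not at hbig
    obtain ⟨A, hA, h2, hAV, hroot⟩ := hbig
    exact h.solvable_of_rootOK IH hA h2 hAV hroot
  by_cases hev : ∃ v ∈ N.V, Even (N.deg {v}) ∧ N.bet {v} = 0
  · obtain ⟨v, hv, hve, hvb, hvW⟩ : ∃ v ∈ N.V, Even (N.deg {v}) ∧ N.bet {v} = 0 ∧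
        ∀ A ⊆ N.V, A.Nonempty → A ≠ N.V → CutOK (N.deg A) (N.bet A) ∨ A = {v} := by
      -- Only one set may be exceptional, so a vertex already exempted by `W` has to be the one that
      -- is dissolved.
      by_cases hW : ∃ v ∈ N.V, W = {v} ∧ Even (N.deg {v}) ∧ N.bet {v} = 0
      · obtain ⟨v, hv, rfl, hv1, hv2⟩ := hW
        exact ⟨v, hv, hv1, hv2, fun A hA h0 hAV => (h.cut A hA h0 hAV).imp_right And.left⟩
      · obtain ⟨v, hv, hv1, hv2⟩ := hev
        refine ⟨v, hv, hv1, hv2, fun A hA h0 hAV => (h.cut A hA h0 hAV).imp_right ?_⟩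
        rintro ⟨rfl, h3, h4⟩
        obtain ⟨u, rfl⟩ := card_eq_one.1 (le_antisymm h.card_le h0.card_pos)
        exact (hW ⟨u, hA (mem_singleton_self u), rfl, h3, h4⟩).elim
    have h' : N.Good {v} := ⟨h.wf, h.sum_b, h.root, (card_singleton v).le,
      fun A hA h0 hAV => (hvW A hA h0 hAV).imp_right fun hAv => ⟨hAv, hAv ▸ hve, hAv ▸ hvb⟩⟩
    exact h'.solvable_of_even hv hcard hve hvb hbig IH
  push Not at hev
  have hcut : ∀ A ⊆ N.V, A.Nonempty → A ≠ N.V → CutOK (N.deg A) (N.bet A) := by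
    intro A hA h0 hAV
    refine (h.cut A hA h0 hAV).resolve_right ?_
    rintro ⟨rfl, h3, h4⟩
    obtain ⟨u, rfl⟩ := card_eq_one.1 (le_antisymm h.card_le h0.card_pos)
    exact hev u (hA (mem_singleton_self u)) h3 h4
  have hne : ∀ v, ({v} : Finset α) ≠ N.V := fun v hv => by
    rw [← hv, card_singleton] at hcard
    omega
  have hcut1 : ∀ v ∈ N.V, CutOK (N.deg {v}) (N.bet {v}) := fun v hv =>
    hcut _ (singleton_subset_iff.2 hv) (singleton_nonempty v) (hne v)
  have h5 : ∀ v ∈ N.V, 5 ≤ N.deg {v} := fun v hv => by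
    have h1 := (hcut1 v hv).1
    by_contra h2
    have h3 : N.deg {v} = 4 := by omega
    exact hev v hv (by rw [h3]; decide) ((hcut1 v hv).2.1 h3)
  have hle : N.deg N.V ≤ 7 := by
    rcases h.root with h1 | h1 | h1 <;> omega
  -- Connectedness: two sides with no edge between them would each have degree at least 4, whereas
  -- there are at most seven external edges.
  have hsplit : ∀ S ⊆ N.V, S.Nonempty → S ≠ N.V →
      ∃ e ∈ N.E, ∃ x ∈ S, ∃ y ∈ N.V \ S, N.Joins e x y := by
    intro S hS h0 hSV
    by_contra hc
    push Not at hc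
    have h1 : ∀ e ∈ N.E, (N.s e ∈ S ↔ N.t e ∈ S) := by
      intro e he
      have h2 := hc e he (N.s e)
      have h3 := hc e he (N.t e)
      have h4 := h.wf e he
      constructor
      · intro hs
        by_contra ht
        exact h2 hs (N.t e) (mem_sdiff.2 ⟨h4.2, ht⟩) (Or.inl ⟨rfl, rfl⟩)
      · intro ht
        by_contra hs
        exact h3 ht (N.s e) (mem_sdiff.2 ⟨h4.1, hs⟩) (Or.inr ⟨rfl, rfl⟩)
    have h2 := deg_add_deg_sdiff h.wf hS h1
    have h3 := (hcut S hS h0 hSV).1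
    have h4 := (hcut (N.V \ S) sdiff_subset
      (sdiff_nonempty.2 fun h => hSV (subset_antisymm hS h)) fun h5 => by
        obtain ⟨x, hx⟩ := h0
        have := h5 ▸ hS hx
        exact (mem_sdiff.1 this).2 hx).1
    omega
  have hedge : ∀ x ∈ N.V, ∃ e ∈ N.E, ∃ y, y ≠ x ∧ N.Joins e y x := by
    intro x hx
    obtain ⟨e, he, x', hx', y, hy, hJ⟩ := hsplit {x} (by simpa) (by simp) (hne x)
    rw [mem_singleton] at hx'
    subst hx'
    exact ⟨e, he, y, by simpa using (mem_sdiff.1 hy).2, hJ.symm⟩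
  -- In degree 5 the vertex can lose an outgoing edge if β = 1 and an incoming one if β = -1; in
  -- degree 6 it is the other way round; from degree 7 on both are possible.
  have hdich : ∀ v ∈ N.V, CutOK (N.deg {v} - 1) (N.bet {v} - 1) ∨
      CutOK (N.deg {v} - 1) (N.bet {v} + 1) := by
    intro v hv
    have h1 := hcut1 v hv
    have h2 := hev v hv
    have h3 := h5 v hv
    generalize N.deg {v} = d at *
    generalize N.bet {v} = β at *
    unfold CutOK at *
    rcases Nat.lt_or_ge d 7 with h7 | h7
    · clear * - h1 h2 h3 h7
      interval_cases d <;> revert β <;> decide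
    · left
      exact ⟨by omega, by omega, by omega⟩
  have hdel : ∀ e ∈ N.E, ∀ x y, y ≠ x → N.Joins e y x →
      CutOK (N.deg {x} - 1) (N.bet {x} + 1) → CutOK (N.deg {y} - 1) (N.bet {y} - 1) →
      N.Solvable := by
    intro e he x y hyx hJ hx hy
    exact h.solvable_of_del hcut hbig he hJ hyx (k := 0) (by norm_num) (i := N.i) (j := N.j)
      (by simp) (fun _ => rfl) h.root hx hy IH
  have hbig' : ∀ A ⊆ N.neg.V, 2 ≤ A.card → A ≠ N.neg.V → ¬ RootOK (N.neg.deg A) (N.neg.bet A) := by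
    intro A hA h2 hAV
    rw [neg_deg, neg_bet]
    simpa only [RootOK, ne_eq, neg_eq_zero] using hbig A hA h2 hAV
  have hcut' : ∀ A ⊆ N.neg.V, A.Nonempty → A ≠ N.neg.V → CutOK (N.neg.deg A) (N.neg.bet A) := by
    intro A hA h2 hAV
    rw [neg_deg, neg_bet]
    exact (hcut A hA h2 hAV).neg
  have IH' : ∀ (N' : Net α ε) (W' : Finset α), N'.size < N.neg.size → N'.Good W' → N'.Solvable := by
    rwa [neg_size]
  have hflip : ∀ v, CutOK (N.neg.deg {v} - 1) (N.neg.bet {v} - 1) ↔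
      CutOK (N.deg {v} - 1) (N.bet {v} + 1) := by
    intro v
    rw [neg_deg, neg_bet]
    exact ⟨fun h => by simpa [add_comm] using h.neg,
        fun h => by simpa [sub_eq_add_neg, add_comm] using h.neg⟩
  have hflip' : ∀ v, CutOK (N.neg.deg {v} - 1) (N.neg.bet {v} + 1) ↔
      CutOK (N.deg {v} - 1) (N.bet {v} - 1) := by
    intro v
    rw [neg_deg, neg_bet]
    exact ⟨fun h => by simpa [sub_eq_add_neg, add_comm] using h.neg,
        fun h => by simpa [sub_eq_add_neg, add_comm] using h.neg⟩
  by_contra hns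
  have hj0 : ∀ x ∈ N.V, CutOK (N.deg {x} - 1) (N.bet {x} + 1) → N.j x = 0 := by
    intro x hx hneg
    by_contra hj
    exact hns (h.solvable_of_del_external hcut hbig hx (by omega) hneg IH)
  have hi0 : ∀ x ∈ N.V, CutOK (N.deg {x} - 1) (N.bet {x} - 1) → N.i x = 0 := by
    intro x hx hpos
    by_contra hi
    exact hns (Solvable.of_neg (h.neg.solvable_of_del_external hcut' hbig' hx
      (show 1 ≤ N.i x by omega) ((hflip' x).2 hpos) IH'))
  have hV0 : N.V.Nonempty := card_pos.1 (by omega)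
  by_cases hall : ∀ x ∈ N.V, CutOK (N.deg {x} - 1) (N.bet {x} - 1)
  · refine hns (h.solvable_of_pos hcut hbig hedge h5 hall (fun x hx hneg => ?_)
      (fun x hx => hi0 x hx (hall x hx)) hV0 IH)
    obtain ⟨e, he, y, hyx, hJ⟩ := hedge x hx
    exact hns (hdel e he x y hyx hJ hneg (hall y (hJ.mem h.wf he).1))
  by_cases hnone : ∀ x ∈ N.V, ¬ CutOK (N.deg {x} - 1) (N.bet {x} - 1)
  · refine hns (Solvable.of_neg (h.neg.solvable_of_pos hcut' hbig' hedge ?_ ?_ ?_ ?_ hV0 IH'))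
    · intro x hx
      rw [neg_deg]
      exact h5 x hx
    · exact fun x hx => (hflip x).2 ((hdich x hx).resolve_left (hnone x hx))
    · exact fun x hx => fun hc => hnone x hx ((hflip' x).1 hc)
    · exact fun x hx => hj0 x hx ((hdich x hx).resolve_left (hnone x hx))
  push Not at hall hnone
  classical
  obtain ⟨e, he, x, hx, y, hy, hJ⟩ := hsplit
    (N.V.filter fun v => CutOK (N.deg {v} - 1) (N.bet {v} - 1)) (filter_subset _ _)
    (by obtain ⟨v, hv⟩ := hnone; exact ⟨v, mem_filter.2 hv⟩)
    (by
      obtain ⟨v, hv, hv'⟩ := hall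
      intro h6
      rw [← h6] at hv
      exact hv' (mem_filter.1 hv).2)
  rw [mem_sdiff, mem_filter] at hy
  rw [mem_filter] at hx
  refine hns (hdel e he y x ?_ hJ ((hdich y hy.1).resolve_left fun h6 => hy.2 ⟨hy.1, h6⟩) hx.2)
  rintro rfl
  exact hy.2 hx

/-! ### Graphs with few small odd cuts. -/

/-- A graph without external edges and demands that has no cuts of size 1 or 5, and at most three
different cuts of size 3. -/
structure FewCuts (N : Net α ε) : Prop where
  wf : N.WF
  zero : ∀ v, N.i v = 0 ∧ N.j v = 0 ∧ N.b v = 0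
  one : ∀ X ⊆ N.V, N.deg X ≠ 1
  five : ∀ X ⊆ N.V, N.deg X ≠ 5
  three : ∀ X : Fin 4 → Finset α, (∀ k, X k ⊆ N.V ∧ N.deg (X k) = 3) →
    ∃ k l, k ≠ l ∧ ∀ e ∈ N.E, cross (X k) (N.s e) (N.t e) = cross (X l) (N.s e) (N.t e)

lemma FewCuts.deg_eq {N : Net α ε} (h : N.FewCuts) (X : Finset α) :
    N.deg X = ∑ e ∈ N.E, cross X (N.s e) (N.t e) := by
  simp [deg, h.zero]

lemma FewCuts.bet_eq {N : Net α ε} (h : N.FewCuts) (X : Finset α) : N.bet X = 0 := by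
  simp [bet, h.zero]

lemma FewCuts.sum_b {N : Net α ε} (h : N.FewCuts) : ∑ v ∈ N.V, N.b v = 0 :=
  sum_eq_zero fun v _ => (h.zero v).2.2

lemma FewCuts.deg_compl {N : Net α ε} (h : N.FewCuts) (X : Finset α) :
    N.deg (N.V \ X) = N.deg X := by
  rw [h.deg_eq, h.deg_eq]
  refine sum_congr rfl fun e he => ?_
  simp [cross, h.wf e he, not_iff_not]

/-- Every cut of the contraction is a cut of `N`, namely that of the expanded set. -/
lemma FewCuts.contract {N : Net α ε} (h : N.FewCuts) {A : Finset α} {a : α} (ha : a ∈ A)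
    (hA : A ⊆ N.V) : (N.contract A a).FewCuts where
  wf := contract_wf h.wf A a
  zero v := by simp [Net.contract, h.zero]
  one X hX := by
    rw [contract_deg N ha hX]
    exact h.one _ (expand_subset ha hA hX)
  five X hX := by
    rw [contract_deg N ha hX]
    exact h.five _ (expand_subset ha hA hX)
  three X hX := by
    obtain ⟨k, l, hkl, h1⟩ := h.three (fun k => expand A a (X k)) fun k =>
      ⟨expand_subset ha hA (hX k).1, (contract_deg N ha (hX k).1).symm.trans (hX k).2⟩
    refine ⟨k, l, hkl, fun e he => ?_⟩
    have h2 : ∀ m, cross (X m) ((N.contract A a).s e) ((N.contract A a).t e) =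
        cross (expand A a (X m)) (N.s e) (N.t e) := fun m =>
      if_congr (iff_congr (mem_expand (hX m).1 _).symm (mem_expand (hX m).1 _).symm) rfl rfl
    rw [h2, h2]
    exact h1 e he

/-- A solution of the graph with `A` identified is balanced outside `A`. -/
lemma FewCuts.exists_of_contract {N : Net α ε} (h : N.FewCuts) {A : Finset α} (hA : A ⊆ N.V)
    (h2 : 2 ≤ A.card)
    (IH : ∀ N' : Net α ε, N'.V.card < N.V.card → N'.FewCuts → N'.Solvable) :
    ∃ f : ε → ZMod 3, (∀ e ∈ N.E, f e ≠ 0) ∧ ∀ v ∈ N.V, v ∉ A → N.div f v = N.b v := by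
  obtain ⟨a, ha⟩ : A.Nonempty := card_pos.1 (by omega)
  have hcard : (N.contract A a).V.card < N.V.card := by
    have := card_insert_le a (N.V \ A)
    have h4 := card_sdiff_add_card_eq_card hA
    simp only [Net.contract]
    omega
  obtain ⟨f, hf, hfV⟩ := IH _ hcard (h.contract ha hA)
  refine ⟨f, hf, fun v hv hvA => ?_⟩
  rw [← contract_div ha f hvA, hfV v (mem_insert_of_mem (mem_sdiff.2 ⟨hv, hvA⟩)),
    ((h.contract ha hA).zero v).2.2, (h.zero v).2.2]

/-- On at most three edges a balanced nowhere-zero function is unique up to sign. -/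
lemma exists_eq_mul_of_card_le_three {C : Finset ε} (hC : C.card ≤ 3) {p q : ε → ZMod 3}
    (hp : ∀ e ∈ C, p e ≠ 0) (hq : ∀ e ∈ C, q e ≠ 0) (hp0 : ∑ e ∈ C, p e = 0)
    (hq0 : ∑ e ∈ C, q e = 0) : ∃ c : ZMod 3, c ≠ 0 ∧ ∀ e ∈ C, p e = c * q e := by
  have h4 : ∀ a b : ZMod 3, a ≠ 0 → b ≠ 0 → a = a * b * b := by decide
  have h5 : ∀ a b : ZMod 3, a ≠ 0 → b ≠ 0 → -a = a * b * -b := by decide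
  have h6 : ∀ a b : ZMod 3, a ≠ 0 → b ≠ 0 → a * b ≠ 0 := by decide
  have h7 : C.card = 0 ∨ C.card = 1 ∨ C.card = 2 ∨ C.card = 3 := by omega
  rcases h7 with h7 | h7 | h7 | h7
  · exact ⟨1, by decide, by simp [card_eq_zero.1 h7]⟩
  · obtain ⟨a, rfl⟩ := card_eq_one.1 h7
    exact absurd (by simpa using hp0) (hp a (by simp))
  · obtain ⟨a, b, hab, rfl⟩ := card_eq_two.1 h7
    rw [sum_pair hab] at hp0 hq0
    refine ⟨p a * q a, h6 _ _ (hp a (by simp)) (hq a (by simp)), fun e he => ?_⟩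
    rcases mem_insert.1 he with rfl | he
    · exact h4 _ _ (hp e (by simp)) (hq e (by simp))
    · rw [mem_singleton] at he
      subst he
      rw [eq_neg_of_add_eq_zero_right hp0, eq_neg_of_add_eq_zero_right hq0]
      exact h5 _ _ (hp a (by simp)) (hq a (by simp))
  · obtain ⟨a, b, c, hab, hac, hbc, rfl⟩ := card_eq_three.1 h7
    -- Three nonzero residues with sum zero are all equal, so each function is constant on the cut.
    have h8 : ∀ x y z : ZMod 3, x ≠ 0 → y ≠ 0 → z ≠ 0 → x + (y + z) = 0 → y = x ∧ z = x := by
      decide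
    rw [sum_insert (by simp [hab, hac]), sum_pair hbc] at hp0 hq0
    obtain ⟨h9, h10⟩ := h8 _ _ _ (hp a (by simp)) (hp b (by simp)) (hp c (by simp)) hp0
    obtain ⟨h11, h12⟩ := h8 _ _ _ (hq a (by simp)) (hq b (by simp)) (hq c (by simp)) hq0
    have h13 := h4 _ _ (hp a (by simp)) (hq a (by simp))
    refine ⟨p a * q a, h6 _ _ (hp a (by simp)) (hq a (by simp)), fun e he => ?_⟩
    simp only [mem_insert, mem_singleton] at he
    rcases he with rfl | rfl | rfl
    · exact h13
    · rwa [h9, h11]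
    · rwa [h10, h12]

lemma sum_crossing_eq {N : Net α ε} (f : ε → ZMod 3) (X : Finset α) :
    ∑ e ∈ N.E.filter (fun e => ¬ (N.s e ∈ X ↔ N.t e ∈ X)),
      f e * ((if N.s e ∈ X then 1 else 0) - (if N.t e ∈ X then 1 else 0)) =
      ∑ v ∈ X, N.div f v := by
  rw [sum_div, sum_filter]
  refine sum_congr rfl fun e _ => ?_
  by_cases N.s e ∈ X <;> by_cases N.t e ∈ X <;> simp_all

lemma FewCuts.card_crossing {N : Net α ε} (h : N.FewCuts) (X : Finset α) :
    (N.E.filter fun e => ¬ (N.s e ∈ X ↔ N.t e ∈ X)).card = N.deg X := by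
  rw [h.deg_eq, card_filter]
  refine sum_congr rfl fun e _ => ?_
  unfold cross
  split_ifs <;> rfl

/-- Flows of the two graphs obtained from a cut of size at most 3 can be combined. -/
lemma FewCuts.solvable_of_cut {N : Net α ε} (h : N.FewCuts) {X : Finset α} (hX : X ⊆ N.V)
    (h2 : 2 ≤ X.card) (h2' : 2 ≤ (N.V \ X).card) (hd : N.deg X ≤ 3)
    (IH : ∀ N' : Net α ε, N'.V.card < N.V.card → N'.FewCuts → N'.Solvable) : N.Solvable := by
  obtain ⟨f, hf, hfV⟩ := h.exists_of_contract hX h2 IH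
  obtain ⟨g, hg, hgV⟩ := h.exists_of_contract sdiff_subset h2' IH
  have hgV' : ∀ v ∈ N.V, v ∈ X → N.div g v = N.b v := fun v hv hvX => hgV v hv (by simp [hvX])
  have hg0 : ∑ v ∈ X, N.div g v = 0 :=
    sum_eq_zero fun v hv => (hgV' v (hX hv) hv).trans (h.zero v).2.2
  have hf0 : ∑ v ∈ X, N.div f v = 0 := by
    have := sum_div_self h.wf f
    rw [← sum_sdiff hX, sum_eq_zero fun v hv => (hfV v (mem_sdiff.1 hv).1
      (mem_sdiff.1 hv).2).trans (h.zero v).2.2, zero_add] at this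
    exact this
  rw [← sum_crossing_eq] at hf0 hg0
  have hσ : ∀ e ∈ N.E.filter (fun e => ¬ (N.s e ∈ X ↔ N.t e ∈ X)),
      ((if N.s e ∈ X then 1 else 0) - (if N.t e ∈ X then 1 else 0) : ZMod 3) ≠ 0 := by
    intro e he
    have := (mem_filter.1 he).2
    by_cases h3 : N.s e ∈ X <;> by_cases h4 : N.t e ∈ X <;> simp [h3, h4] at this ⊢
  obtain ⟨c, hc, hcC⟩ := exists_eq_mul_of_card_le_three ((h.card_crossing X).trans_le hd)
    (fun e he => mul_ne_zero (hf e (mem_filter.1 he).1) (hσ e he))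
    (fun e he => mul_ne_zero (hg e (mem_filter.1 he).1) (hσ e he)) hf0 hg0
  refine N.solvable_of_agree X f (fun e => c * g e) hf (fun e he => mul_ne_zero hc (hg e he)) hfV
    ?_ ?_
  · intro v hv hvX
    have : N.div (fun e => c * g e) v = c * N.div g v := by
      simp only [div, mul_sum, mul_assoc]
    rw [this, hgV' v hv hvX, (h.zero v).2.2, mul_zero]
  · intro e he hcr
    have he' := (mem_filter (p := fun e => ¬ (N.s e ∈ X ↔ N.t e ∈ X))).2 ⟨he, hcr⟩
    have := hcC e he'
    rw [← mul_assoc] at this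
    exact mul_right_cancel₀ (hσ e he') this

/-- Vertices of degree 0 or 2 can be suppressed. -/
lemma FewCuts.solvable_of_deg_le_two {N : Net α ε} (h : N.FewCuts) {v : α} (hv : v ∈ N.V)
    (hcard : 2 ≤ N.V.card) (hd : N.deg {v} = 0 ∨ N.deg {v} = 2)
    (IH : ∀ N' : Net α ε, N'.V.card < N.V.card → N'.FewCuts → N'.Solvable) : N.Solvable := by
  set C := N.E.filter fun e => ¬ (N.s e ∈ ({v} : Finset α) ↔ N.t e ∈ ({v} : Finset α)) with hC
  have hCcard : C.card = N.deg {v} := h.card_crossing {v}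
  have hdiv : ∀ f : ε → ZMod 3, N.div f v = ∑ e ∈ C, f e *
      ((if N.s e ∈ ({v} : Finset α) then 1 else 0) - (if N.t e ∈ ({v} : Finset α) then 1 else 0)) :=
    fun f => by rw [hC, sum_crossing_eq, sum_singleton]
  have main : ∀ x ∈ N.V, x ≠ v → ∃ f : ε → ZMod 3, (∀ e ∈ N.E, f e ≠ 0) ∧
      ∀ u ∈ N.V, u ≠ x → u ≠ v → N.div f u = N.b u := by
    intro x hx hxv
    obtain ⟨f, hf, hfV⟩ := h.exists_of_contract (A := {v, x})
      (by simp [insert_subset_iff, hv, hx]) (card_pair hxv.symm).ge IH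
    exact ⟨f, hf, fun u hu hux huv => hfV u hu (by simp [hux, huv])⟩
  rcases hd with hd | hd
  · obtain ⟨x, hxV, hxv⟩ : ∃ x ∈ N.V, x ≠ v := exists_mem_ne (by omega) v
    obtain ⟨f, hf, hfV⟩ := main x hxV hxv
    refine solvable_of_forall_ne h.wf h.sum_b x f hf fun u hu hux => ?_
    by_cases huv : u = v
    · subst huv
      rw [hdiv, card_eq_zero.1 (hCcard.trans hd), sum_empty, (h.zero u).2.2]
    · exact hfV u hu hux huv
  · obtain ⟨e₁, e₂, hne, hC2⟩ := card_eq_two.1 (hCcard.trans hd)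
    have he₁ : e₁ ∈ C := by simp [hC2]
    have he₂ : e₂ ∈ C := by simp [hC2]
    obtain ⟨x, hxv, hJ⟩ : ∃ x, x ≠ v ∧ N.Joins e₁ v x := by
      have := (mem_filter.1 he₁).2
      simp only [mem_singleton] at this
      by_cases hs : N.s e₁ = v
      · exact ⟨N.t e₁, by tauto, Or.inl ⟨hs, rfl⟩⟩
      · exact ⟨N.s e₁, hs, Or.inr ⟨rfl, by tauto⟩⟩
    obtain ⟨f, hf, hfV⟩ := main x (hJ.mem h.wf (mem_filter.1 he₁).1).2 hxv
    obtain ⟨σ, hσ, hσ'⟩ := hJ.exists_sign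
    have hτ : ∃ τ : ZMod 3, τ ≠ 0 ∧ ((if N.s e₂ ∈ ({v} : Finset α) then 1 else 0) -
        (if N.t e₂ ∈ ({v} : Finset α) then 1 else 0) : ZMod 3) = τ := by
      refine ⟨_, ?_, rfl⟩
      have := (mem_filter.1 he₂).2
      by_cases h3 : N.s e₂ = v <;> by_cases h4 : N.t e₂ = v <;> simp [h3, h4] at this ⊢
    obtain ⟨τ, hτ, hτ'⟩ := hτ
    have hσ2 := hσ' v
    simp only [hxv, if_true, if_false, sub_zero] at hσ2
    have hfe₂ := hf e₂ (mem_filter.1 he₂).1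
    -- After contracting `v` with `x` along `e₁`, the value of `e₁` is free; it is chosen to cancel
    -- that of `e₂` at `v`.
    refine solvable_of_forall_ne h.wf h.sum_b x (Function.update f e₁ (- f e₂ * τ * σ)) ?_
      fun u hu hux => ?_
    · intro e he
      by_cases h1 : e = e₁
      · subst h1
        simp [hfe₂, hτ, hσ]
      · rw [Function.update_of_ne h1]
        exact hf e he
    · by_cases huv : u = v
      · subst huv
        rw [hdiv, hC2, sum_pair hne, Function.update_self, Function.update_of_ne hne.symm, hτ',
          (h.zero u).2.2]
        simp only [mem_singleton]
        rw [mul_assoc _ σ, hσ2]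
        ring
      · rw [← hfV u hu hux huv]
        refine sum_congr rfl fun e he => ?_
        by_cases h1 : e = e₁
        · have h5 : N.s e ≠ u ∧ N.t e ≠ u := by
            subst h1
            rcases hJ with ⟨h3, h4⟩ | ⟨h3, h4⟩ <;> rw [h3, h4] <;>
              simp [Ne.symm huv, Ne.symm hux]
          rw [if_neg h5.1, if_neg h5.2, sub_self, mul_zero, mul_zero]
        · rw [Function.update_of_ne h1]

/-- Handshake count, with loops left out because they contribute to no cut. -/
lemma FewCuts.sum_deg {N : Net α ε} (h : N.FewCuts) (T : Finset α) :
    ∑ x ∈ T, N.deg {x} = N.deg T +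
      2 * (N.E.filter fun e => N.s e ∈ T ∧ N.t e ∈ T ∧ N.s e ≠ N.t e).card := by
  rw [sum_congr rfl fun x _ => h.deg_eq {x}, h.deg_eq, sum_comm, card_filter, mul_sum,
    ← sum_add_distrib]
  refine sum_congr rfl fun e _ => ?_
  have h1 : ∀ x ∈ T, cross {x} (N.s e) (N.t e) = if N.s e = N.t e then 0 else
      (if N.s e = x then 1 else 0) + (if N.t e = x then 1 else 0) := by
    intro x _
    simp only [cross, mem_singleton]
    by_cases h1 : N.s e = x <;> by_cases h2 : N.t e = x <;> by_cases h3 : N.s e = N.t e <;> simp_all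
  rw [sum_congr rfl h1]
  by_cases h3 : N.s e = N.t e
  · simp [h3, cross]
  · simp only [h3, if_false, sum_add_distrib, sum_ite_eq]
    by_cases N.s e ∈ T <;> by_cases N.t e ∈ T <;> simp_all [cross]

/-- Deleting one external edge entering `w` and one leaving `w'`. -/
lemma solvable_of_del_two {M : Net α ε} (hM : M.WF) (hb : ∑ v ∈ M.V, M.b v = 0)
    (hbet : ∀ A ⊆ M.V, M.bet A = 0) {w w' : α} (hw : w ∈ M.V) (hw' : w' ∈ M.V)
    (hj : 1 ≤ M.j w) (hi : 1 ≤ M.i w') (hdV : M.deg M.V = 6 ∨ M.deg M.V = 9)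
    (hcut : ∀ A ⊆ M.V, A.Nonempty → A ≠ M.V → M.deg A = 4 ∨ 6 ≤ M.deg A)
    (hbig : ∀ A ⊆ M.V, 2 ≤ A.card → M.deg A = 6 ∨ 8 ≤ M.deg A)
    (hdw : M.deg {w} ≠ 4) (hdw' : M.deg {w'} ≠ 4) (hne : w ≠ w' ∨ M.deg {w} ≠ 7) :
    M.Solvable := by
  set j : α → ℕ := fun u => M.j u - (if w = u then 1 else 0) with hjdef
  set i : α → ℕ := fun u => M.i u - (if w' = u then 1 else 0) with hidef
  have hj' : ∀ u, j u + (if w = u then 1 else 0) = M.j u := by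
    intro u
    simp only [hjdef]
    by_cases hxu : w = u
    · subst hxu
      simp
      omega
    · simp [hxu]
  have hi' : ∀ u, i u + (if w' = u then 1 else 0) = M.i u := by
    intro u
    simp only [hidef]
    by_cases hxu : w' = u
    · subst hxu
      simp
      omega
    · simp [hxu]
  have hsum : ∀ A : Finset α, ∑ u ∈ A, j u + (if w ∈ A then 1 else 0) = ∑ u ∈ A, M.j u := by
    intro A
    rw [← sum_ite_eq A w (fun _ => 1), ← sum_add_distrib, sum_congr rfl fun u _ => hj' u]
  have hsum' : ∀ A : Finset α, ∑ u ∈ A, i u + (if w' ∈ A then 1 else 0) = ∑ u ∈ A, M.i u := by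
    intro A
    rw [← sum_ite_eq A w' (fun _ => 1), ← sum_add_distrib, sum_congr rfl fun u _ => hi' u]
  set N : Net α ε := { M with i := i, j := j } with hN
  have hd : ∀ A, N.deg A + (if w ∈ A then 1 else 0) + (if w' ∈ A then 1 else 0) = M.deg A := by
    intro A
    have := hsum A
    have := hsum' A
    simp only [deg, hN, sum_add_distrib]
    omega
  have hbN : ∀ A ⊆ M.V, N.bet A = (if w ∈ A then 1 else 0) - (if w' ∈ A then 1 else 0) := by
    intro A hA
    have h1 := congrArg (Nat.cast : ℕ → ZMod 3) (hsum A)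
    have h2 := congrArg (Nat.cast : ℕ → ZMod 3) (hsum' A)
    have h3 := hbet A hA
    push_cast at h1 h2
    simp only [bet, hN, sum_add_distrib, sum_sub_distrib] at h3 ⊢
    linear_combination h3 - h1 + h2
  -- The two forgotten edges are already accounted for in `b`, so solvability is unchanged while the
  -- root degree falls to 4 or 7 with boundary zero.
  refine show N.Solvable from Good.solvable N ∅ ⟨hM, hb, ?_, by simp, ?_⟩
  · have h1 := hd M.V
    have h2 := hbN M.V subset_rfl
    simp only [hw, hw', if_true, sub_self] at h1 h2
    change RootOK (N.deg M.V) (N.bet M.V)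
    rw [h2]
    unfold RootOK
    rcases hdV with h3 | h3
    · left; omega
    · right; right; exact ⟨by omega, rfl⟩
  · intro A hA hA0 hAV
    left
    have hdA := hd A
    rw [hbN A hA]
    have h0 := hcut A hA hA0 hAV
    have h8 : 2 ≤ A.card ∨ ∃ u, A = {u} := by
      rcases Nat.lt_or_ge A.card 2 with h3 | h3
      · exact Or.inr (card_eq_one.1 (by have := hA0.card_pos; omega))
      · exact Or.inl h3
    have h6 : w ∈ A → 6 ≤ M.deg A := fun hwA => by
      rcases h8 with h8 | ⟨u, rfl⟩
      · have := hbig A hA h8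
        omega
      · rw [← mem_singleton.1 hwA] at h0 ⊢
        omega
    have h6' : w' ∈ A → 6 ≤ M.deg A := fun hwA => by
      rcases h8 with h8 | ⟨u, rfl⟩
      · have := hbig A hA h8
        omega
      · rw [← mem_singleton.1 hwA] at h0 ⊢
        omega
    by_cases hwA : w ∈ A <;> by_cases hwA' : w' ∈ A <;>
      simp only [hwA, hwA', if_true, if_false, sub_self, sub_zero, zero_sub] at hdA ⊢
    · have h7 : M.deg A ≠ 7 := by
        rcases h8 with h8 | ⟨u, rfl⟩
        · have := hbig A hA h8
          omega
        · rw [mem_singleton] at hwA hwA'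
          subst hwA
          subst hwA'
          exact hne.resolve_left (by simp)
      have := h6 hwA
      exact ⟨by omega, fun _ => rfl, by omega⟩
    · have := h6 hwA
      exact ⟨by omega, by omega, fun _ => by decide⟩
    · have := h6' hwA'
      exact ⟨by omega, by omega, fun _ => by decide⟩
    · exact ⟨by omega, fun _ => rfl, by omega⟩

/-- Every edge inside `T` is at the vertex `r`: the edges at `T` are directed out of `r` and into
the other vertices of `T`. -/
def starFlow (N : Net α ε) (T : Finset α) (r : α) (e : ε) : ZMod 3 :=
  if N.s e ∈ T then (if N.s e = r then 1 else -1)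
  else if N.t e ∈ T then (if N.t e = r then -1 else 1) else 1

lemma starFlow_ne_zero (N : Net α ε) (T : Finset α) (r : α) (e : ε) : N.starFlow T r e ≠ 0 := by
  unfold starFlow
  split_ifs <;> decide

/-- The three edges at `x` all leave it or all enter it, and 3 = 0. Edges inside `T` cause no
conflict because one of their ends is the source `r`. -/
lemma FewCuts.div_starFlow {N : Net α ε} (h : N.FewCuts) {T : Finset α} {r : α}
    (hr : ∀ e ∈ N.E, N.s e ∈ T → N.t e ∈ T → N.s e ≠ N.t e → N.s e = r ∨ N.t e = r) {x : α}
    (hx : x ∈ T) (hd : N.deg {x} = 3) : N.div (N.starFlow T r) x = 0 := by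
  have h1 : N.div (N.starFlow T r) x = (if x = r then 1 else -1) * (N.deg {x} : ℕ) := by
    rw [h.deg_eq, Nat.cast_sum, mul_sum]
    refine sum_congr rfl fun e he => ?_
    have hre := hr e he
    unfold starFlow cross
    simp only [mem_singleton]
    by_cases hs : N.s e = x <;> by_cases ht : N.t e = x
    · simp [hs, ht]
    · simp [hs, ht, hx]
    · by_cases hsT : N.s e ∈ T
      · have := hre hsT (ht ▸ hx) (fun h => hs (h.trans ht))
        by_cases hxr : x = r
        · subst hxr
          simp [hs, ht, hsT]
        · have hsr : N.s e = r := this.resolve_right (fun h => hxr (ht ▸ h))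
          have hrT : r ∈ T := hsr ▸ hsT
          simp [hsr, ht, hxr, hrT, Ne.symm hxr]
      · by_cases hxr : x = r
        · subst hxr
          simp [hs, ht, hsT, hx]
        · simp [hs, ht, hsT, hx, hxr]
    · simp [hs, ht]
  rw [h1, hd]
  have : ((3 : ℕ) : ZMod 3) = 0 := by decide
  rw [this, mul_zero]

/-! ### Structure of a minimal counterexample. -/

section minimal

variable {N : Net α ε} (h : N.FewCuts)
  (IH : ∀ N' : Net α ε, N'.V.card < N.V.card → N'.FewCuts → N'.Solvable)
  (hns : ¬ N.Solvable)

include h IH hns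

lemma FewCuts.two_le_card : 2 ≤ N.V.card := by
  by_contra hc
  exact hns (solvable_of_card_lt_two h.wf h.sum_b (by omega))

/-- Cuts of at most three edges with two vertices on both sides are removed by gluing, and vertices
of degree 0 or 2 by suppression. -/
lemma FewCuts.deg_large {X : Finset α} (hX : X ⊆ N.V) (h0 : X.Nonempty) (hXV : X ≠ N.V) :
    N.deg X = 4 ∨ 6 ≤ N.deg X ∨ (N.deg X = 3 ∧ (X.card = 1 ∨ (N.V \ X).card = 1)) := by
  have h0' : (N.V \ X).Nonempty := sdiff_nonempty.2 fun h => hXV (subset_antisymm hX h)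
  have h1 := h.one X hX
  have h5 := h.five X hX
  have h2 : X.card = 1 ∨ (N.V \ X).card = 1 ∨ 4 ≤ N.deg X := by
    by_contra hc
    push Not at hc
    have := h0.card_pos
    have := h0'.card_pos
    exact hns (h.solvable_of_cut hX (by omega) (by omega) (by omega) IH)
  have h3 : ∀ v ∈ N.V, N.deg {v} ≠ 0 ∧ N.deg {v} ≠ 2 := fun v hv => by
    rw [← not_or]
    exact fun hd => hns (h.solvable_of_deg_le_two hv (h.two_le_card IH hns) hd IH)
  have h4 : X.card = 1 → N.deg X ≠ 0 ∧ N.deg X ≠ 2 := fun hc => by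
    obtain ⟨v, rfl⟩ := card_eq_one.1 hc
    exact h3 v (hX (mem_singleton_self v))
  have h4' : (N.V \ X).card = 1 → N.deg X ≠ 0 ∧ N.deg X ≠ 2 := fun hc => by
    rw [← h.deg_compl]
    obtain ⟨v, hv⟩ := card_eq_one.1 hc
    rw [hv]
    exact h3 v (sdiff_subset (hv ▸ mem_singleton_self v))
  omega

/-- Among four vertices of degree 3, two have the same cut; all their edges then join them to each
other, so the pair has degree 0, which is too small. -/
lemma FewCuts.card_deg_three_le : (N.V.filter fun v => N.deg {v} = 3).card ≤ 3 := by
  by_contra hc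
  obtain ⟨S, hS, hScard⟩ := exists_subset_card_eq
    (show 4 ≤ (N.V.filter fun v => N.deg {v} = 3).card by omega)
  let φ := S.equivFinOfCardEq hScard
  have hmem : ∀ k, ((φ.symm k : S) : α) ∈ N.V ∧ N.deg {((φ.symm k : S) : α)} = 3 := fun k =>
    mem_filter.1 (hS (φ.symm k).2)
  obtain ⟨k, l, hkl, h1⟩ := h.three (fun k => {((φ.symm k : S) : α)}) fun k =>
    ⟨singleton_subset_iff.2 (hmem k).1, (hmem k).2⟩
  set x : α := ((φ.symm k : S) : α)
  set y : α := ((φ.symm l : S) : α)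
  have hxy : x ≠ y := fun h => hkl (φ.symm.injective (Subtype.ext h))
  have hd : N.deg {x, y} = 0 := by
    rw [h.deg_eq]
    refine sum_eq_zero fun e he => ?_
    have := h1 e he
    simp only [cross, mem_singleton, mem_insert] at this ⊢
    by_cases N.s e = x <;> by_cases N.s e = y <;> by_cases N.t e = x <;> by_cases N.t e = y <;>
      simp_all
  have h2 := h.deg_large IH hns (X := {x, y})
    (by simp [insert_subset_iff, (hmem k).1, (hmem l).1, x, y]) (by simp) (by
      intro h3
      have h4 := card_le_card (hS.trans (filter_subset _ _))
      have h5 := card_le_two (a := x) (b := y)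
      rw [h3] at h5
      omega)
  omega

/-- A 3-edge-cut isolates a vertex of degree 3. It cannot be in `A`, and if it is all of the
complement of `A`, then `A` is already the full set of vertices of other degrees. -/
lemma FewCuts.deg_large_of_disjoint {A : Finset α}
    (hA : A ⊆ N.V \ N.V.filter fun v => N.deg {v} = 3) (h0 : A.Nonempty)
    (hAU : A ≠ N.V \ N.V.filter fun v => N.deg {v} = 3) : N.deg A = 4 ∨ 6 ≤ N.deg A := by
  have hAV := hA.trans sdiff_subset
  rcases h.deg_large IH hns hAV h0
    (fun h1 => hAU (subset_antisymm hA (h1 ▸ sdiff_subset))) with h1 | h1 | ⟨h1, h2 | h2⟩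
  · exact Or.inl h1
  · exact Or.inr h1
  · obtain ⟨v, rfl⟩ := card_eq_one.1 h2
    have := hA (mem_singleton_self v)
    simp [h1] at this
  · exfalso
    obtain ⟨v, hv⟩ := card_eq_one.1 h2
    have hdv := h.deg_compl A
    rw [hv, h1] at hdv
    refine hAU (subset_antisymm hA fun u hu => ?_)
    by_contra huA
    have : u ∈ N.V \ A := mem_sdiff.2 ⟨(mem_sdiff.1 hu).1, huA⟩
    rw [hv, mem_singleton] at this
    subst this
    simp [hdv] at hu

/-- Large sets without vertices of degree 3 do not give cuts of size 4 or 7. -/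
lemma FewCuts.deg_large_of_two_le {A : Finset α}
    (hA : A ⊆ N.V \ N.V.filter fun v => N.deg {v} = 3) (h2 : 2 ≤ A.card)
    (hAU : A ≠ N.V \ N.V.filter fun v => N.deg {v} = 3) : N.deg A = 6 ∨ 8 ≤ N.deg A := by
  have hAV := hA.trans sdiff_subset
  have h0 : A.Nonempty := card_pos.1 (by omega)
  by_contra hc
  obtain ⟨f, hf, hfV⟩ := h.exists_of_contract hAV h2 IH
  have hV : (N.sub A f).V = A := rfl
  refine hns (solvable_of_sub hf hfV (Good.solvable _ ∅ ⟨N.sub_wf A f,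
    sum_sub_b h.wf h.sum_b hAV hfV, ?_, by simp, fun B hB hB0 hBA => Or.inl ?_⟩))
  · rw [hV, sub_deg N f subset_rfl, N.sub_bet hf, h.bet_eq]
    have := h.deg_large_of_disjoint IH hns hA h0 hAU
    unfold RootOK
    -- These are exactly the remaining sizes at which a set of boundary zero can serve as the inside
    -- of a root.
    have : N.deg A = 4 ∨ N.deg A = 7 := by omega
    rcases this with h3 | h3
    · left; omega
    · exact Or.inr (Or.inr ⟨h3, rfl⟩)
  · rw [hV] at hB hBA
    rw [sub_deg N f hB, N.sub_bet hf, h.bet_eq]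
    have := h.deg_large_of_disjoint IH hns (hB.trans hA) hB0
      fun h3 => hBA (subset_antisymm hB (h3 ▸ hA))
    exact ⟨by omega, fun _ => rfl, by omega⟩

/-- There is a vertex at which all edges between vertices of degree 3 are. -/
lemma FewCuts.exists_center : ∃ r, ∀ e ∈ N.E, N.deg {N.s e} = 3 → N.deg {N.t e} = 3 →
    N.s e ≠ N.t e → N.s e = r ∨ N.t e = r := by
  set T := N.V.filter fun v => N.deg {v} = 3 with hT
  have hmem : ∀ e ∈ N.E, N.deg {N.s e} = 3 → N.deg {N.t e} = 3 → N.s e ∈ T ∧ N.t e ∈ T :=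
    fun e he h1 h2 => ⟨mem_filter.2 ⟨(h.wf e he).1, h1⟩, mem_filter.2 ⟨(h.wf e he).2, h2⟩⟩
  by_contra hc
  push Not at hc
  have hcard := h.card_deg_three_le IH hns
  rw [← hT] at hcard
  obtain ⟨v₀, -⟩ : N.V.Nonempty := card_pos.1 (by have := h.two_le_card IH hns; omega)
  -- An edge inside `T`, one avoiding its first end and one avoiding its second end: on at most
  -- three vertices these form a triangle.
  obtain ⟨e₀, he₀, hs₀, ht₀, hst₀, -, -⟩ := hc v₀
  obtain ⟨e₁, he₁, hs₁, ht₁, hst₁, hs₁', ht₁'⟩ := hc (N.s e₀)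
  obtain ⟨e₂, he₂, hs₂, ht₂, hst₂, hs₂', ht₂'⟩ := hc (N.t e₀)
  have m₀ := hmem e₀ he₀ hs₀ ht₀
  have m₁ := hmem e₁ he₁ hs₁ ht₁
  have m₂ := hmem e₂ he₂ hs₂ ht₂
  have hthree : ∃ z, T = {N.s e₀, N.t e₀, z} ∧ z ≠ N.s e₀ ∧ z ≠ N.t e₀ := by
    obtain ⟨z, hzT, hzs, hzt⟩ : ∃ z ∈ T, z ≠ N.s e₀ ∧ z ≠ N.t e₀ := by
      by_cases h3 : N.s e₁ = N.t e₀
      · exact ⟨N.t e₁, m₁.2, ht₁', fun h4 => hst₁ (h3.trans h4.symm)⟩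
      · exact ⟨N.s e₁, m₁.1, hs₁', h3⟩
    refine ⟨z, (eq_of_subset_of_card_le ?_ ?_).symm, hzs, hzt⟩
    · simp [insert_subset_iff, m₀, hzT]
    · rwa [card_eq_three.2 ⟨_, _, z, hst₀, hzs.symm, hzt.symm, rfl⟩]
  obtain ⟨z, hTz, hzs, hzt⟩ := hthree
  have hT3 : T.card = 3 := by
    rw [hTz, card_eq_three.2 ⟨_, _, z, hst₀, hzs.symm, hzt.symm, rfl⟩]
  have hsum := h.sum_deg T
  rw [sum_congr rfl fun x hx => (mem_filter.1 hx).2, sum_const, hT3, smul_eq_mul] at hsum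
  have h01 : e₀ ≠ e₁ := by
    rintro rfl
    exact hs₁' rfl
  have h02 : e₀ ≠ e₂ := by
    rintro rfl
    exact ht₂' rfl
  have h12 : e₁ ≠ e₂ := by
    rintro rfl
    have h3 := m₁.1
    have h4 := m₁.2
    rw [hTz] at h3 h4
    simp only [mem_insert, mem_singleton, hs₁', ht₁', hs₂', ht₂', false_or] at h3 h4
    exact hst₁ (h3.trans h4.symm)
  -- The degrees in `T` sum to 9, so three inner edges leave an odd cut of size at most 3 around
  -- `T`.
  have hm : 3 ≤ (N.E.filter fun e => N.s e ∈ T ∧ N.t e ∈ T ∧ N.s e ≠ N.t e).card := by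
    rw [← card_eq_three.2 ⟨e₀, e₁, e₂, h01, h02, h12, rfl⟩]
    refine card_le_card ?_
    simp only [insert_subset_iff, singleton_subset_iff, mem_filter]
    exact ⟨⟨he₀, m₀.1, m₀.2, hst₀⟩, ⟨he₁, m₁.1, m₁.2, hst₁⟩, ⟨he₂, m₂.1, m₂.2, hst₂⟩⟩
  have hTV : T ≠ N.V := fun h3 => by
    have h4 := deg_V h.wf
    rw [← h3, sum_eq_zero fun v _ => by simp [h.zero v]] at h4
    rw [h4] at hsum
    omega
  rcases h.deg_large IH hns (X := T) (filter_subset _ _) ⟨_, m₀.1⟩ hTV with h3 | h3 | ⟨h3, h4 | h4⟩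
  · omega
  · omega
  · omega
  · have h5 := h.deg_compl T
    obtain ⟨u, hu⟩ := card_eq_one.1 h4
    rw [hu, h3] at h5
    have h6 : u ∈ N.V \ T := hu ▸ mem_singleton_self u
    rw [mem_sdiff, hT, mem_filter] at h6
    exact h6.2 ⟨h6.1, h5⟩

/-- A vertex joined to a vertex of degree 3 does not have degree 4. -/
lemma FewCuts.deg_ne_four {e : ε} (he : e ∈ N.E) {u x : α} (hJ : N.Joins e u x)
    (hx : N.deg {x} = 3) (hT : 2 ≤ (N.V.filter fun v => N.deg {v} = 3).card)
    (hdU : N.deg (N.V \ N.V.filter fun v => N.deg {v} = 3) ≠ 4) : N.deg {u} ≠ 4 := by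
  intro hu
  obtain ⟨huV, hxV⟩ := hJ.mem h.wf he
  have hux : u ≠ x := by
    rintro rfl
    omega
  have hsum := h.sum_deg {u, x}
  rw [sum_pair hux, hu, hx] at hsum
  have hm : 1 ≤ (N.E.filter fun e => N.s e ∈ ({u, x} : Finset α) ∧ N.t e ∈ ({u, x} : Finset α) ∧
      N.s e ≠ N.t e).card := by
    refine card_pos.2 ⟨e, mem_filter.2 ⟨he, ?_⟩⟩
    rcases hJ with ⟨h3, h4⟩ | ⟨h3, h4⟩ <;> rw [h3, h4] <;> simp [hux, hux.symm]
  have hsub : {u, x} ⊆ N.V := by simp [insert_subset_iff, huV, hxV]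
  have h1 := h.one _ hsub
  have h5 := h.five _ hsub
  obtain ⟨y, hy, hyx⟩ := exists_mem_ne
    (show 1 < (N.V.filter fun v => N.deg {v} = 3).card by omega) x
  rw [mem_filter] at hy
  have hyu : y ≠ u := by
    rintro rfl
    omega
  -- The pair `{u, x}` has odd degree at most 5, hence 3, so its complement is the single vertex
  -- `y`.
  rcases h.deg_large IH hns hsub (by simp) (fun h3 => by
    have := h3 ▸ hy.1
    simp [hyx, hyu] at this) with h3 | h3 | ⟨h3, h4 | h4⟩
  · omega
  · omega
  · rw [card_pair hux] at h4
    omega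
  · obtain ⟨z, hz⟩ := card_eq_one.1 h4
    have hyz : y ∈ N.V \ {u, x} := by simp [hy.1, hyx, hyu]
    rw [hz, mem_singleton] at hyz
    subst hyz
    -- Now `u` is the only vertex whose degree is not 3, and the excluded cut is that of `u`.
    refine hdU ?_
    convert hu using 2
    ext v
    simp only [mem_sdiff, mem_filter, mem_singleton, not_and]
    constructor
    · rintro ⟨hv, hv'⟩
      by_contra hvu
      by_cases hvx : v = x
      · exact hv' hv (hvx ▸ hx)
      · have : v ∈ N.V \ {u, x} := by simp [hv, hvu, hvx]
        rw [hz, mem_singleton] at this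
        exact hv' hv (this ▸ hy.2)
    · rintro rfl
      exact ⟨huV, fun _ => by omega⟩

lemma FewCuts.false_of_minimal : False := by
  set T := N.V.filter fun v => N.deg {v} = 3 with hT
  have hTcard : T.card ≤ 3 := h.card_deg_three_le IH hns
  have hTV : T ⊆ N.V := filter_subset _ _
  have hTd : ∀ x ∈ T, N.deg {x} = 3 := fun x hx => (mem_filter.1 hx).2
  have hsum := h.sum_deg T
  rw [sum_congr rfl hTd, sum_const, smul_eq_mul] at hsum
  have hdU : N.deg (N.V \ T) = N.deg T := h.deg_compl T
  set m := (N.E.filter fun e => N.s e ∈ T ∧ N.t e ∈ T ∧ N.s e ≠ N.t e).card with hm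
  have hstar : ∀ r, (∀ e ∈ N.E, N.s e ∈ T → N.t e ∈ T → N.s e ≠ N.t e → N.s e = r ∨ N.t e = r) →
      ∀ v ∈ N.V, v ∉ N.V \ T → N.div (N.starFlow T r) v = N.b v := by
    intro r hr v hv hvU
    have hvT : v ∈ T := by simpa [hv] using hvU
    rw [h.div_starFlow hr hvT (hTd v hvT), (h.zero v).2.2]
  have hcut : ∀ A ⊆ N.V \ T, A.Nonempty → A ≠ N.V \ T → N.deg A = 4 ∨ 6 ≤ N.deg A :=
    fun A hA h0 hAU => h.deg_large_of_disjoint IH hns hA h0 hAU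
  by_cases hroot : RootOK (N.deg (N.V \ T)) 0
  · obtain ⟨r, hr⟩ := h.exists_center IH hns
    have hr' : ∀ e ∈ N.E, N.s e ∈ T → N.t e ∈ T → N.s e ≠ N.t e → N.s e = r ∨ N.t e = r :=
      fun e he hs ht => hr e he (hTd _ hs) (hTd _ ht)
    have hf : ∀ e ∈ N.E, N.starFlow T r e ≠ 0 := fun e _ => N.starFlow_ne_zero T r e
    refine hns (solvable_of_sub hf (hstar r hr') (Good.solvable _ ∅ ⟨N.sub_wf _ _,
      sum_sub_b h.wf h.sum_b sdiff_subset (hstar r hr'), ?_, by simp,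
      fun B hB hB0 hBA => Or.inl ?_⟩))
    · change RootOK ((N.sub (N.V \ T) _).deg (N.V \ T)) ((N.sub (N.V \ T) _).bet (N.V \ T))
      rwa [sub_deg N _ subset_rfl, N.sub_bet hf, h.bet_eq]
    · replace hB : B ⊆ N.V \ T := hB
      rw [sub_deg N _ hB, N.sub_bet hf, h.bet_eq]
      have := hcut B hB hB0 hBA
      exact ⟨by omega, fun _ => rfl, by omega⟩
  -- The cut around `T` has size 3|T| - 2m with |T| ≤ 3; excluding sizes up to 5 and size 7 leaves
  -- only 6 and 9.
  have hT2 : 2 ≤ T.card ∧ m = 0 := by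
    have : ¬ (N.deg (N.V \ T) ≤ 5 ∨ N.deg (N.V \ T) = 7) := fun hc =>
      hroot (hc.imp_right fun h3 => Or.inr ⟨h3, rfl⟩)
    omega
  have hindep : ∀ e ∈ N.E, N.s e ∈ T → N.t e ∈ T → N.s e = N.t e := by
    intro e he hs ht
    by_contra hst
    have := card_eq_zero.1 (hm.symm.trans hT2.2)
    have h3 : e ∈ N.E.filter fun e => N.s e ∈ T ∧ N.t e ∈ T ∧ N.s e ≠ N.t e :=
      mem_filter.2 ⟨he, hs, ht, hst⟩
    rw [this] at h3
    simp at h3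
  have hdU' : N.deg (N.V \ T) = 6 ∨ N.deg (N.V \ T) = 9 := by omega
  have hbig : ∀ A ⊆ N.V \ T, 2 ≤ A.card → N.deg A = 6 ∨ 8 ≤ N.deg A := by
    intro A hA h2
    by_cases hAU : A = N.V \ T
    · rw [hAU]
      omega
    · exact h.deg_large_of_two_le IH hns hA h2 hAU
  obtain ⟨r, hr, y, hy, hry⟩ := one_lt_card.1 (show 1 < T.card by omega)
  have hr' : ∀ e ∈ N.E, N.s e ∈ T → N.t e ∈ T → N.s e ≠ N.t e → N.s e = r ∨ N.t e = r :=
    fun e he hs ht hst => (hst (hindep e he hs ht)).elim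
  have hf : ∀ e ∈ N.E, N.starFlow T r e ≠ 0 := fun e _ => N.starFlow_ne_zero T r e
  have hend : ∀ x ∈ T, ∃ e ∈ N.E, ∃ w ∈ N.V \ T, N.Joins e x w := by
    intro x hx
    have h3 : 0 < (N.E.filter fun e =>
        ¬ (N.s e ∈ ({x} : Finset α) ↔ N.t e ∈ ({x} : Finset α))).card := by
      rw [h.card_crossing, hTd x hx]
      norm_num
    obtain ⟨e, he⟩ := card_pos.1 h3
    obtain ⟨he, hcr⟩ := mem_filter.1 he
    have hst := hindep e he
    have hwf := h.wf e he
    simp only [mem_singleton] at hcr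
    by_cases hs : N.s e = x
    · exact ⟨e, he, N.t e, mem_sdiff.2 ⟨hwf.2, fun ht =>
        hcr (by simp [← hst (hs ▸ hx) ht, hs])⟩, Or.inl ⟨hs, rfl⟩⟩
    · have ht : N.t e = x := by tauto
      exact ⟨e, he, N.s e, mem_sdiff.2 ⟨hwf.1, fun hs' => hs ((hst hs' (ht ▸ hx)).trans ht)⟩,
        Or.inr ⟨rfl, ht⟩⟩
  -- The source `r` supplies an external edge entering `w`, the sink `y` one leaving `w'`.
  -- Forgetting both works unless `w = w'` has degree 7.
  have main : ∀ e₁ ∈ N.E, ∀ e₂ ∈ N.E, ∀ w ∈ N.V \ T, ∀ w' ∈ N.V \ T, N.Joins e₁ r w →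
      N.Joins e₂ y w' → w = w' ∧ N.deg {w} = 7 := by
    intro e₁ he₁ e₂ he₂ w hw w' hw' hJ₁ hJ₂
    have hsing : ∀ {u}, u ∈ N.V \ T → ({u} : Finset α) ⊆ N.V \ T := singleton_subset_iff.2
    have hdw := h.deg_ne_four IH hns he₁ hJ₁.symm (hTd r hr) hT2.1 (by rw [← hT]; omega)
    have hdw' := h.deg_ne_four IH hns he₂ hJ₂.symm (hTd y hy) hT2.1 (by rw [← hT]; omega)
    have hwT := (mem_sdiff.1 hw).2
    have hwT' := (mem_sdiff.1 hw').2
    by_contra hc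
    have hV : (N.sub (N.V \ T) (N.starFlow T r)).V = N.V \ T := rfl
    refine hns (solvable_of_sub hf (hstar r hr') (solvable_of_del_two (w := w) (w' := w')
      (N.sub_wf _ _) (sum_sub_b h.wf h.sum_b sdiff_subset (hstar r hr')) ?_ hw hw' ?_ ?_ ?_ ?_ ?_ ?_
      ?_ ?_))
    · intro A hA
      rw [N.sub_bet hf, h.bet_eq]
    · refine le_add_left ?_
      refine le_trans ?_ (single_le_sum (fun e _ => Nat.zero_le _) (mem_filter.2 ⟨he₁, ?_⟩))
      · rcases hJ₁ with ⟨h3, h4⟩ | ⟨h3, h4⟩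
        · simp [h3, h4, starFlow, hr]
        · have : (-1 : ZMod 3) ≠ 1 := by decide
          simp [h3, h4, starFlow, hr, hwT, this]
      · rcases hJ₁ with ⟨h3, h4⟩ | ⟨h3, h4⟩ <;> simp [h3, h4, hr, hTV hr, hw]
    · refine le_add_left ?_
      refine le_trans ?_ (single_le_sum (fun e _ => Nat.zero_le _) (mem_filter.2 ⟨he₂, ?_⟩))
      · rcases hJ₂ with ⟨h3, h4⟩ | ⟨h3, h4⟩
        · have : (-1 : ZMod 3) ≠ 1 := by decide
          simp [h3, h4, starFlow, hy, hry.symm, this]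
        · simp [h3, h4, starFlow, hy, hwT', hry.symm]
      · rcases hJ₂ with ⟨h3, h4⟩ | ⟨h3, h4⟩ <;> simp [h3, h4, hy, hTV hy, hw']
    · rwa [hV, sub_deg N _ subset_rfl]
    · intro A hA h0 hAU
      rw [sub_deg N _ (show A ⊆ N.V \ T from hA)]
      exact hcut A hA h0 hAU
    · intro A hA h2
      rw [sub_deg N _ (show A ⊆ N.V \ T from hA)]
      exact hbig A hA h2
    · rwa [sub_deg N _ (hsing hw)]
    · rwa [sub_deg N _ (hsing hw')]
    · rw [sub_deg N _ (hsing hw)]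
      tauto
  obtain ⟨e₁, he₁, w, hw, hJ₁⟩ := hend r hr
  obtain ⟨e₂, he₂, w', hw', hJ₂⟩ := hend y hy
  obtain ⟨rfl, hdw⟩ := main e₁ he₁ e₂ he₂ w hw w' hw' hJ₁ hJ₂
  have hr_end : ∀ e ∈ N.E, ∀ u, N.Joins e r u → u ≠ r → u = w := by
    intro e he u hJ hur
    have huU : u ∈ N.V \ T := by
      refine mem_sdiff.2 ⟨(hJ.mem h.wf he).2, fun huT => ?_⟩
      have := hindep e he
      rcases hJ with ⟨h3, h4⟩ | ⟨h3, h4⟩ <;> rw [h3, h4] at this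
      exacts [hur (this hr huT).symm, hur (this huT hr)]
    exact (main e he e₂ he₂ u huU w hw hJ hJ₂).1
  have hy_end : ∀ e ∈ N.E, ∀ u, N.Joins e y u → u ≠ y → u = w := by
    intro e he u hJ huy
    have huU : u ∈ N.V \ T := by
      refine mem_sdiff.2 ⟨(hJ.mem h.wf he).2, fun huT => ?_⟩
      have := hindep e he
      rcases hJ with ⟨h3, h4⟩ | ⟨h3, h4⟩ <;> rw [h3, h4] at this
      exacts [huy (this hy huT).symm, huy (this huT hy)]
    exact (main e₁ he₁ e he w hw u huU hJ₁ hJ).1.symm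
  have hwr : w ≠ r := fun h3 => (mem_sdiff.1 hw).2 (h3 ▸ hr)
  have hwy : w ≠ y := fun h3 => (mem_sdiff.1 hw).2 (h3 ▸ hy)
  -- All edges at `r` and `y` end at `w`, so of the seven edges at `w` only one leaves the triple.
  have hd : N.deg {w, r, y} + (N.deg {r} + N.deg {y}) = N.deg {w} := by
    rw [h.deg_eq, h.deg_eq, h.deg_eq, h.deg_eq, ← sum_add_distrib, ← sum_add_distrib]
    refine sum_congr rfl fun e he => ?_
    have h1 := fun h3 => hr_end e he (N.t e) (Or.inl ⟨h3, rfl⟩)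
    have h2 := fun h3 => hr_end e he (N.s e) (Or.inr ⟨rfl, h3⟩)
    have h3 := fun h3 => hy_end e he (N.t e) (Or.inl ⟨h3, rfl⟩)
    have h4 := fun h3 => hy_end e he (N.s e) (Or.inr ⟨rfl, h3⟩)
    simp only [cross, mem_insert, mem_singleton]
    grind
  rw [hTd r hr, hTd y hy, hdw] at hd
  exact h.one {w, r, y} (by
    simp [insert_subset_iff, (mem_sdiff.1 hw).1, hTV hr, hTV hy]) (by omega)

end minimal

/-- A graph without cuts of size 1 or 5 and with at most three cuts of size 3 has a nowhere-zero
flow modulo 3. -/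
theorem FewCuts.solvable (N : Net α ε) (h : N.FewCuts) : N.Solvable := by
  induction hn : N.V.card using Nat.strong_induction_on generalizing N with
  | _ n IH =>
  by_contra hns
  exact h.false_of_minimal (fun N' hN' h' => IH _ (hn ▸ hN') N' h' rfl) hns

end Net

end NetTheory

/-! ### From flows modulo 3 to integer flows. -/

section IntegerFlow

set_option linter.unusedSectionVars false

open Finset

namespace Net

variable {α ε : Type*} [DecidableEq α] [DecidableEq ε]

/-- The boundary of an integer function on the edges. -/
def intDiv (N : Net α ε) (g : ε → ℤ) (v : α) : ℤ :=
  ∑ e ∈ N.E, g e * ((if N.s e = v then 1 else 0) - (if N.t e = v then 1 else 0))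

/-- An integer function with values `±1`, `±2` that is a flow modulo 3. -/
structure IsModFlow (N : Net α ε) (g : ε → ℤ) : Prop where
  value : ∀ e ∈ N.E, g e = 1 ∨ g e = -1 ∨ g e = 2 ∨ g e = -2
  dvd : ∀ v ∈ N.V, 3 ∣ N.intDiv g v

/-- The flow `g` is positive along some edge from `x` to `y`. -/
def Step (N : Net α ε) (g : ε → ℤ) (x y : α) : Prop :=
  ∃ e ∈ N.E, (N.s e = x ∧ N.t e = y ∧ 0 < g e) ∨ (N.s e = y ∧ N.t e = x ∧ g e < 0)

/-- The total excess of `g`. -/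
def excess (N : Net α ε) (g : ε → ℤ) : ℕ := ∑ v ∈ N.V, (N.intDiv g v).natAbs

lemma sum_intDiv (N : Net α ε) (g : ε → ℤ) (A : Finset α) :
    ∑ v ∈ A, N.intDiv g v =
      ∑ e ∈ N.E, g e * ((if N.s e ∈ A then 1 else 0) - (if N.t e ∈ A then 1 else 0)) := by
  unfold intDiv
  rw [sum_comm]
  refine sum_congr rfl fun e _ => ?_
  rw [← mul_sum, sum_sub_distrib, sum_ite_eq, sum_ite_eq]

lemma intDiv_update {N : Net α ε} {e : ε} (he : e ∈ N.E) (g : ε → ℤ) (c : ℤ) (v : α) :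
    N.intDiv (Function.update g e (g e + c)) v = N.intDiv g v +
      c * ((if N.s e = v then 1 else 0) - (if N.t e = v then 1 else 0)) := by
  unfold intDiv
  rw [← add_sum_erase _ _ he, ← add_sum_erase _ _ he, Function.update_self,
    sum_congr rfl fun e' he' => by rw [Function.update_of_ne (ne_of_mem_erase he')]]
  ring

/-- Pushing three units back along one edge. -/
lemma IsModFlow.exists_push {N : Net α ε} (hN : N.WF) {g : ε → ℤ} (hg : N.IsModFlow g) {v w : α}
    (hvw : v ≠ w) (hstep : N.Step g v w) : w ∈ N.V ∧ ∃ g', N.IsModFlow g' ∧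
      (∀ u, N.intDiv g' u =
          N.intDiv g u - 3 * ((if v = u then 1 else 0) - (if w = u then 1 else 0)))
      ∧ ∀ x y, x ≠ v → y ≠ v → N.Step g x y → N.Step g' x y := by
  obtain ⟨e, he, hend⟩ := hstep
  have hval := hg.value e he
  -- In the direction in which it is positive, the value 1 becomes -2 and 2 becomes -1, so the range
  -- is preserved.
  obtain ⟨c, hc, hdiv⟩ : ∃ c : ℤ, (g e + c = 1 ∨ g e + c = -1 ∨ g e + c = 2 ∨ g e + c = -2) ∧
      ∀ u, c * ((if N.s e = u then 1 else 0) - (if N.t e = u then 1 else 0)) =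
        - 3 * ((if v = u then 1 else 0) - (if w = u then 1 else 0)) := by
    rcases hend with ⟨rfl, rfl, h⟩ | ⟨rfl, rfl, h⟩
    · exact ⟨-3, by omega, fun u => rfl⟩
    · exact ⟨3, by omega, fun u => by ring⟩
  have hdiv' : ∀ u, N.intDiv (Function.update g e (g e + c)) u =
      N.intDiv g u - 3 * ((if v = u then 1 else 0) - (if w = u then 1 else 0)) := fun u => by
    rw [intDiv_update he, hdiv]
    ring
  refine ⟨?_, Function.update g e (g e + c), ⟨fun e' he' => ?_, fun u hu => ?_⟩, hdiv', ?_⟩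
  · rcases hend with ⟨-, rfl, -⟩ | ⟨rfl, -, -⟩
    exacts [(hN e he).2, (hN e he).1]
  · by_cases h : e' = e
    · subst h
      rwa [Function.update_self]
    · rw [Function.update_of_ne h]
      exact hg.value e' he'
  · rw [hdiv']
    exact dvd_sub (hg.dvd u hu) (dvd_mul_right _ _)
  · rintro x y hx hy ⟨e', he', h⟩
    have hne : e' ≠ e := by
      rintro rfl
      rcases hend with ⟨h1, h2, -⟩ | ⟨h1, h2, -⟩ <;> rcases h with ⟨h3, h4, -⟩ | ⟨h3, h4, -⟩ <;>
        simp_all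
    refine ⟨e', he', ?_⟩
    rwa [Function.update_of_ne hne]

/-- Along a path from a vertex of positive to one of negative boundary, the excess can be
decreased. -/
lemma IsModFlow.exists_excess_lt_of_path {N : Net α ε} (hN : N.WF) (n : ℕ) :
    ∀ (g : ε → ℤ) (p : ℕ → α), N.IsModFlow g → p 0 ∈ N.V → 0 < N.intDiv g (p 0) →
      N.intDiv g (p n) < 0 → (∀ k < n, N.Step g (p k) (p (k + 1))) →
      ∃ g', N.IsModFlow g' ∧ N.excess g' < N.excess g := by
  induction n using Nat.strong_induction_on with
  | _ n IH =>
  intro g p hg h0 hpos hneg hp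
  rcases n with _ | n
  · omega
  -- A path that returns to its start is shortcut, so that changing the first edge does not disturb
  -- the later steps.
  by_cases hret : ∃ k, 1 ≤ k ∧ k ≤ n + 1 ∧ p k = p 0
  · obtain ⟨k, hk1, hk2, hk⟩ := hret
    refine IH (n + 1 - k) (by omega) g (fun m => p (m + k)) hg ?_ ?_ ?_ ?_
    · simpa [hk] using h0
    · simpa [hk] using hpos
    · simpa [Nat.sub_add_cancel hk2] using hneg
    · intro m hm
      have := hp (m + k) (by omega)
      rwa [show m + k + 1 = m + 1 + k by ring] at this
  push Not at hret
  have h1 : p 1 ≠ p 0 := hret 1 le_rfl (by omega)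
  obtain ⟨hwV, g', hg', hdiv, hstep⟩ := hg.exists_push hN h1.symm (hp 0 (by omega))
  have hdv := hdiv (p 0)
  have hdw := hdiv (p 1)
  simp only [h1, h1.symm, if_true, if_false] at hdv hdw
  have hother : ∀ u, u ≠ p 0 → u ≠ p 1 → N.intDiv g' u = N.intDiv g u := fun u hu hu' => by
    rw [hdiv, if_neg hu.symm, if_neg hu'.symm]
    ring
  have hexc : ∀ f : ε → ℤ, N.excess f = (N.intDiv f (p 0)).natAbs + ((N.intDiv f (p 1)).natAbs +
      ∑ v ∈ (N.V.erase (p 0)).erase (p 1), (N.intDiv f v).natAbs) := fun f => by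
    rw [add_sum_erase _ (fun v => (N.intDiv f v).natAbs) (mem_erase.2 ⟨h1, hwV⟩),
      add_sum_erase _ (fun v => (N.intDiv f v).natAbs) h0]
    rfl
  have hrest : ∑ v ∈ (N.V.erase (p 0)).erase (p 1), (N.intDiv g' v).natAbs =
      ∑ v ∈ (N.V.erase (p 0)).erase (p 1), (N.intDiv g v).natAbs :=
    sum_congr rfl fun v hv => by
      rw [hother v (ne_of_mem_erase (mem_of_mem_erase hv)) (ne_of_mem_erase hv)]
  have hE := hexc g
  have hE' := hexc g'
  rw [hrest] at hE'
  have hd0 := hg.dvd _ h0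
  have hd1 := hg.dvd _ hwV
  -- Boundaries are multiples of 3, so the push lowers the excess at `p 0` by 3. If `p 1` was
  -- negative its excess drops as well; otherwise the total is unchanged and the surplus has moved
  -- one step along the path.
  rcases lt_or_ge (N.intDiv g (p 1)) 0 with hlt | hge
  · exact ⟨g', hg', by omega⟩
  · have hn1 : p (n + 1) ≠ p 1 := fun h => by
      rw [h] at hneg
      omega
    obtain ⟨g'', hg'', hlt⟩ := IH n (by omega) g' (fun k => p (k + 1)) hg' hwV
      (by
        show 0 < N.intDiv g' (p 1)
        omega)
      (by
        show N.intDiv g' (p (n + 1)) < 0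
        rwa [hother _ (hret _ (by omega) le_rfl) hn1])
      (fun k hk => hstep _ _ (hret _ (by omega) (by omega)) (hret _ (by omega) (by omega))
        (hp (k + 1) (by omega)))
    exact ⟨g'', hg'', by omega⟩

lemma exists_path_of_reflTransGen {r : α → α → Prop} {x y : α} (h : Relation.ReflTransGen r x y) :
    ∃ (n : ℕ) (p : ℕ → α), p 0 = x ∧ p n = y ∧ ∀ k < n, r (p k) (p (k + 1)) := by
  induction h using Relation.ReflTransGen.head_induction_on with
  | refl => exact ⟨0, fun _ => y, rfl, rfl, by simp⟩
  | @head a c hac _ ih =>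
    obtain ⟨n, p, h0, hn, hp⟩ := ih
    refine ⟨n + 1, fun k => k.casesOn a p, rfl, hn, fun k hk => ?_⟩
    rcases k with _ | k
    · simpa [h0] using hac
    · exact hp k (by omega)

/-- No edge carries flow out of the set reachable from a vertex of positive boundary. The boundaries
in that set therefore sum to at most zero, and some vertex in it is negative. -/
lemma IsModFlow.exists_excess_lt {N : Net α ε} (hN : N.WF) {g : ε → ℤ} (hg : N.IsModFlow g)
    (hpos : 0 < N.excess g) : ∃ g', N.IsModFlow g' ∧ N.excess g' < N.excess g := by
  classical
  have hsum : ∑ v ∈ N.V, N.intDiv g v = 0 := by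
    rw [sum_intDiv]
    exact sum_eq_zero fun e he => by simp [hN e he]
  obtain ⟨v, hv, hvpos⟩ : ∃ v ∈ N.V, 0 < N.intDiv g v := by
    by_contra hc
    push Not at hc
    have h1 := (sum_eq_zero_iff_of_nonpos hc).1 hsum
    have : N.excess g = 0 := sum_eq_zero fun v hv => by rw [h1 v hv]; rfl
    omega
  set S := N.V.filter fun u => Relation.ReflTransGen (N.Step g) v u with hS
  have hvS : v ∈ S := mem_filter.2 ⟨hv, Relation.ReflTransGen.refl⟩
  obtain ⟨u, hu, hneg⟩ : ∃ u ∈ S, N.intDiv g u < 0 := by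
    by_contra hc
    push Not at hc
    have h1 : N.intDiv g v ≤ ∑ u ∈ S, N.intDiv g u := single_le_sum hc hvS
    have h2 : ∑ u ∈ S, N.intDiv g u ≤ 0 := by
      rw [sum_intDiv]
      refine sum_nonpos fun e he => ?_
      have hst : N.s e ∈ S → N.t e ∉ S → g e ≤ 0 := fun hs ht => by
        by_contra hge
        exact ht (mem_filter.2 ⟨(hN e he).2, (mem_filter.1 hs).2.tail
          ⟨e, he, Or.inl ⟨rfl, rfl, by omega⟩⟩⟩)
      have hts : N.t e ∈ S → N.s e ∉ S → 0 ≤ g e := fun ht hs => by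
        by_contra hge
        exact hs (mem_filter.2 ⟨(hN e he).1, (mem_filter.1 ht).2.tail
          ⟨e, he, Or.inr ⟨rfl, rfl, by omega⟩⟩⟩)
      by_cases hs : N.s e ∈ S <;> by_cases ht : N.t e ∈ S <;> simp only [hs, ht, if_true, if_false]
      · simp
      · have := hst hs ht
        omega
      · have := hts ht hs
        omega
      · simp
    omega
  obtain ⟨n, p, rfl, rfl, hp⟩ := exists_path_of_reflTransGen (mem_filter.1 hu).2
  exact IsModFlow.exists_excess_lt_of_path hN n g p hg hv hvpos hneg hp

/-- Tutte's theorem: a nowhere-zero flow modulo 3 yields an integer flow with values `±1`, `±2`. -/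
theorem exists_int_flow {N : Net α ε} (hN : N.WF) {f : ε → ZMod 3} (hf : ∀ e ∈ N.E, f e ≠ 0)
    (hdiv : ∀ v ∈ N.V, N.div f v = 0) :
    ∃ g : ε → ℤ, (∀ e ∈ N.E, g e = 1 ∨ g e = -1 ∨ g e = 2 ∨ g e = -2) ∧
      ∀ v ∈ N.V, N.intDiv g v = 0 := by
  have key : ∀ n, ∀ g, N.IsModFlow g → N.excess g = n → ∃ g', N.IsModFlow g' ∧ N.excess g' = 0 := by
    intro n
    induction n using Nat.strong_induction_on with
    | _ n IH =>
    intro g hg hn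
    rcases Nat.eq_zero_or_pos n with rfl | hpos
    · exact ⟨g, hg, hn⟩
    · obtain ⟨g', hg', hlt⟩ := hg.exists_excess_lt hN (hn ▸ hpos)
      exact IH _ (hn ▸ hlt) g' hg' rfl
  have h0 : N.IsModFlow fun e => if f e = 1 then 1 else -1 := by
    refine ⟨fun e _ => ?_, fun v hv => ?_⟩
    · split_ifs <;> simp
    · refine (ZMod.intCast_zmod_eq_zero_iff_dvd _ 3).1 ?_
      rw [← hdiv v hv, intDiv, div]
      push_cast
      refine sum_congr rfl fun e he => ?_
      congr 1
      have := hf e he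
      generalize f e = c at *
      revert c
      decide
  obtain ⟨g, hg, hg0⟩ := key _ _ h0 rfl
  refine ⟨g, hg.value, fun v hv => ?_⟩
  exact Int.natAbs_eq_zero.1 (sum_eq_zero_iff.1 hg0 v hv)

end Net

end IntegerFlow

/-! ### Translation between graphs and networks. -/

section GraphFlow

open Finset

namespace Graph

variable {α β : Type*}

lemma isNowhereZeroThreeFlow_iff [DecidableEq α] {G : Graph α β} [Fintype G.edgeSet]
    (D : G.EdgeOrientation) (f : G.edgeSet → ℤ) :
    G.IsNowhereZeroThreeFlow D f ↔ (∀ e, f e = 1 ∨ f e = -1 ∨ f e = 2 ∨ f e = -2) ∧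
      ∀ v ∈ G.vertexSet, ∑ e, f e *
        ((if D.tail e = v then 1 else 0) - (if D.head e = v then 1 else 0)) = 0 := by
  classical
  have h : ∀ (r : G.edgeSet → α) v, ∑ᶠ e ∈ {e | r e = v}, f e =
      ∑ e, f e * (if r e = v then 1 else 0) := fun r v => by
    rw [finsum_mem_def, finsum_eq_sum_of_fintype]
    refine sum_congr rfl fun e _ => ?_
    simp [Set.indicator_apply]
  unfold IsNowhereZeroThreeFlow
  refine and_congr_right fun _ => forall₂_congr fun v _ => ?_
  rw [h, h, ← sub_eq_zero, ← sum_sub_distrib]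
  simp only [mul_sub]

open Classical in
/-- The network of a finite graph. -/
noncomputable def toNet (G : Graph α β) (hV : G.vertexSet.Finite) [Fintype G.edgeSet]
    (D : G.EdgeOrientation) : Net α G.edgeSet where
  V := hV.toFinset
  E := univ
  s := D.tail
  t := D.head
  i := 0
  j := 0
  b := 0

open Classical in
lemma mem_edgeCut_iff {G : Graph α β} (D : G.EdgeOrientation) (X : Finset α) (e : G.edgeSet) :
    (e : β) ∈ G.edgeCut X ↔ Net.cross X (D.tail e) (D.head e) = 1 := by
  have h1 := D.isLink e
  unfold Net.cross
  constructor
  · rintro ⟨x, y, hxy, hx, hy⟩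
    rw [if_neg]
    rcases h1.eq_and_eq_or_eq_and_eq hxy with ⟨h2, h3⟩ | ⟨h2, h3⟩ <;> rw [h2, h3] <;>
      simp_all
  · intro h
    by_cases hs : D.tail e ∈ X <;> by_cases ht : D.head e ∈ X <;> simp [hs, ht] at h
    · exact ⟨_, _, h1, hs, ht⟩
    · exact ⟨_, _, h1.symm, ht, hs⟩

open Classical in
lemma encard_edgeCut {G : Graph α β} (hV : G.vertexSet.Finite) [Fintype G.edgeSet]
    (D : G.EdgeOrientation) (X : Finset α) :
    (G.edgeCut (X : Set α)).encard = ((G.toNet hV D).deg X : ℕ) := by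
  have h1 : G.edgeCut (X : Set α) = Subtype.val '' ((univ.filter fun e : G.edgeSet =>
      Net.cross X (D.tail e) (D.head e) = 1 : Finset G.edgeSet) : Set G.edgeSet) := by
    ext e
    simp only [Set.mem_image, mem_coe, mem_filter, mem_univ, true_and, ← mem_edgeCut_iff]
    constructor
    · intro he
      have h2 : e ∈ G.edgeSet := by
        obtain ⟨x, y, h, -⟩ := he
        exact h.edge_mem
      exact ⟨⟨e, h2⟩, he, rfl⟩
    · rintro ⟨e, he, rfl⟩
      exact he
  rw [h1, Subtype.val_injective.encard_image, Set.encard_coe_eq_coe_finsetCard, card_filter]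
  congr 1
  have h2 : (G.toNet hV D).deg X = ∑ e, Net.cross X (D.tail e) (D.head e) := by
    simp [Net.deg, toNet]
  rw [h2]
  refine sum_congr rfl fun e _ => ?_
  unfold Net.cross
  split_ifs <;> simp_all

/-- A walk avoiding the only edge of the cut can never leave `X`. -/
lemma IsBridge.of_edgeCut_eq {G : Graph α β} {X : Set α} {e : β} (h : G.edgeCut X = {e}) :
    G.IsBridge e := by
  obtain ⟨x, y, hxy, hx, hy⟩ : e ∈ G.edgeCut X := by rw [h]; rfl
  refine ⟨x, y, hxy, fun hr => hy ?_⟩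
  clear hxy hy
  induction hr with
  | refl => exact hx
  | @tail a c _ hac ih =>
    by_contra hc
    obtain ⟨e', he'⟩ := hac
    rw [deleteEdges_isLink] at he'
    have : e' ∈ G.edgeCut X := ⟨a, c, he'.1, ih, hc⟩
    rw [h] at this
    exact he'.2 this

-- A cut of size 1 would be a bridge, and four sets with pairwise different cuts of size 3 would
-- give four 3-edge-cuts.
open Classical in
lemma fewCuts_toNet {G : Graph α β} (hV : G.vertexSet.Finite) [Fintype G.edgeSet]
    (D : G.EdgeOrientation) (hb : G.Bridgeless) (h5 : G.edgeCutsOfSize 5 = ∅)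
    (h3 : (G.edgeCutsOfSize 3).encard ≤ 3) : (G.toNet hV D).FewCuts where
  wf e _ := by
    simp only [toNet, Set.Finite.mem_toFinset]
    exact ⟨(D.isLink e).left_mem, (D.isLink e).right_mem⟩
  zero v := ⟨rfl, rfl, rfl⟩
  one X hX hd := by
    have h1 := encard_edgeCut hV D X
    rw [hd] at h1
    obtain ⟨e, he⟩ := Set.encard_eq_one.1 (by simpa using h1)
    exact hb e (IsBridge.of_edgeCut_eq he)
  five X hX hd := by
    have h1 := encard_edgeCut hV D X
    rw [hd] at h1
    have : G.edgeCut (X : Set α) ∈ G.edgeCutsOfSize 5 :=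
      ⟨h1, X, fun v hv => hV.mem_toFinset.1 (hX hv), rfl⟩
    rw [h5] at this
    exact this
  three X hX := by
    by_contra hc
    push Not at hc
    have hinj : Function.Injective fun k => G.edgeCut (X k : Set α) := by
      intro k l hkl
      by_contra hne
      obtain ⟨e, -, he⟩ := hc k l hne
      have h1 := mem_edgeCut_iff D (X k) e
      have h2 := mem_edgeCut_iff D (X l) e
      simp only at hkl
      rw [hkl, h2] at h1
      refine he ?_
      simp only [toNet]
      unfold Net.cross at h1 ⊢
      split_ifs at h1 ⊢ <;> simp_all
    have hsub : Set.range (fun k => G.edgeCut (X k : Set α)) ⊆ G.edgeCutsOfSize 3 := by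
      rintro _ ⟨k, rfl⟩
      refine ⟨?_, X k, fun v hv => hV.mem_toFinset.1 ((hX k).1 hv), rfl⟩
      rw [encard_edgeCut hV D, (hX k).2]
    have h4 := (Set.encard_le_encard hsub).trans h3
    rw [← Set.image_univ, hinj.encard_image, Set.encard_univ] at h4
    simp at h4
    exact absurd h4 (by norm_num)

theorem hasNowhereZeroThreeFlow {G : Graph α β} (hV : G.vertexSet.Finite)
    (hE : G.edgeSet.Finite) (hb : G.Bridgeless) (h5 : G.edgeCutsOfSize 5 = ∅)
    (h3 : (G.edgeCutsOfSize 3).encard ≤ 3) : G.HasNowhereZeroThreeFlow := by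
  classical
  have := hE.fintype
  choose s t hst using fun e : G.edgeSet => exists_isLink_of_mem_edgeSet e.2
  let D : G.EdgeOrientation := ⟨s, t, hst⟩
  have hfew := fewCuts_toNet hV D hb h5 h3
  obtain ⟨f, hf, hdiv⟩ := hfew.solvable
  obtain ⟨g, hg, hg0⟩ := Net.exists_int_flow hfew.wf hf hdiv
  exact ⟨D, g, (isNowhereZeroThreeFlow_iff D g).2 ⟨fun e => hg e (mem_univ e),
    fun v hv => hg0 v (hV.mem_toFinset.2 hv)⟩⟩

/-! ### Sharpness: the complete graph on four vertices. -/

lemma completeFour_isLink {e : Sym2 (Fin 4)} {x y : Fin 4} :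
    completeFour.IsLink e x y ↔ e = s(x, y) ∧ x ≠ y := by
  constructor
  · rintro ⟨rfl, h⟩
    exact ⟨rfl, by simpa using h⟩
  · rintro ⟨rfl, h⟩
    exact ⟨rfl, by simpa using h⟩

lemma completeFour_bridgeless : completeFour.Bridgeless := by
  rintro e ⟨x, y, h, hn⟩
  obtain ⟨rfl, hxy⟩ := completeFour_isLink.1 h
  obtain ⟨z, hzx, hzy⟩ := (by decide : ∀ x y : Fin 4, ∃ z : Fin 4, z ≠ x ∧ z ≠ y) x y
  refine hn ((Relation.ReflTransGen.single (b := z) ⟨s(x, z), ?_⟩).tail ⟨s(z, y), ?_⟩)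
  all_goals rw [deleteEdges_isLink]
  · exact ⟨completeFour_isLink.2 ⟨rfl, hzy⟩, by simp [hzx, hzy]⟩
  · exact ⟨completeFour_isLink.2 ⟨rfl, hzx.symm⟩, by simp [hxy, hzy]⟩

/-- The edges of `K₄` leaving `X`. -/
def completeFourCut (X : Finset (Fin 4)) : Finset (Sym2 (Fin 4)) :=
  (X ×ˢ Xᶜ).image fun p => s(p.1, p.2)

lemma edgeCut_completeFour (X : Finset (Fin 4)) :
    completeFour.edgeCut (X : Set (Fin 4)) = (completeFourCut X : Set (Sym2 (Fin 4))) := by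
  ext e
  simp only [edgeCut, completeFourCut, completeFour_isLink, Set.mem_ofPred_eq, coe_image,
    Set.mem_image, mem_coe, mem_product, mem_compl, Prod.exists]
  constructor
  · rintro ⟨x, y, ⟨rfl, -⟩, hx, hy⟩
    exact ⟨x, y, ⟨hx, hy⟩, rfl⟩
  · rintro ⟨x, y, ⟨hx, hy⟩, rfl⟩
    exact ⟨x, y, ⟨rfl, fun h => hy (h ▸ hx)⟩, hx, hy⟩

lemma mem_edgeCutsOfSize_completeFour {k : ℕ} {C : Set (Sym2 (Fin 4))} :
    C ∈ completeFour.edgeCutsOfSize k ↔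
      ∃ X : Finset (Fin 4), (completeFourCut X).card = k ∧ C = completeFourCut X := by
  classical
  constructor
  · rintro ⟨hk, X, -, rfl⟩
    obtain ⟨Y, rfl⟩ := X.toFinite.exists_finset_coe
    rw [edgeCut_completeFour] at hk ⊢
    rw [Set.encard_coe_eq_coe_finsetCard] at hk
    exact ⟨Y, by exact_mod_cast hk, rfl⟩
  · rintro ⟨X, hX, rfl⟩
    exact ⟨by rw [Set.encard_coe_eq_coe_finsetCard, hX], X, fun _ _ => trivial,
      (edgeCut_completeFour X).symm⟩

lemma edgeCutsOfSize_five_completeFour : completeFour.edgeCutsOfSize 5 = ∅ := by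
  ext C
  rw [mem_edgeCutsOfSize_completeFour, Set.mem_empty_iff_false, iff_false]
  rintro ⟨X, hX, -⟩
  revert X
  decide

lemma encard_edgeCutsOfSize_three_completeFour :
    (completeFour.edgeCutsOfSize 3).encard = 4 := by
  have h : completeFour.edgeCutsOfSize 3 =
      Set.range fun v : Fin 4 => (completeFourCut {v} : Set (Sym2 (Fin 4))) := by
    ext C
    rw [mem_edgeCutsOfSize_completeFour]
    constructor
    · rintro ⟨X, hX, rfl⟩
      have : ∃ v, completeFourCut {v} = completeFourCut X := by
        revert X
        decide
      obtain ⟨v, hv⟩ := this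
      exact ⟨v, congrArg _ hv⟩
    · rintro ⟨v, rfl⟩
      refine ⟨{v}, ?_, rfl⟩
      revert v
      decide
  have hinj : Function.Injective fun v : Fin 4 => (completeFourCut {v} : Set (Sym2 (Fin 4))) := by
    intro v w hvw
    exact (by decide : ∀ v w, completeFourCut {v} = completeFourCut {w} → v = w) v w
      (coe_injective hvw)
  rw [h, ← Set.image_univ, hinj.encard_image, Set.encard_univ]
  simp

/-- Modulo 3, the three outgoing values at a vertex of degree 3 are equal, so each vertex is a
source or a sink. Three mutually adjacent vertices cannot alternate between the two. -/
lemma not_hasNowhereZeroThreeFlow_completeFour : ¬ completeFour.HasNowhereZeroThreeFlow := by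
  classical
  rintro ⟨D, f, hf⟩
  have : Fintype completeFour.edgeSet := Fintype.ofFinite _
  obtain ⟨hval, hsum⟩ := (isNowhereZeroThreeFlow_iff D f).1 hf
  have hmem : ∀ x y : Fin 4, x ≠ y → s(x, y) ∈ completeFour.edgeSet := fun x y h =>
    (completeFour_isLink.2 ⟨rfl, h⟩).edge_mem
  -- The orientation is normalised: up to a sign of its value, each edge may be taken as directed
  -- from `x` to `y`.
  have hσ : ∀ x y (h : x ≠ y), ∃ σ : ZMod 3, σ ≠ 0 ∧ ∀ v,
      ((f ⟨s(x, y), hmem x y h⟩ * ((if D.tail ⟨s(x, y), hmem x y h⟩ = v then 1 else 0) -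
        (if D.head ⟨s(x, y), hmem x y h⟩ = v then 1 else 0)) : ℤ) : ZMod 3) =
        σ * ((if x = v then 1 else 0) - (if y = v then 1 else 0)) := by
    intro x y h
    set e : completeFour.edgeSet := ⟨s(x, y), hmem x y h⟩
    have hne : (f e : ZMod 3) ≠ 0 := by
      rcases hval e with h1 | h1 | h1 | h1 <;> rw [h1] <;> decide
    have hl : completeFour.IsLink e x y := completeFour_isLink.2 ⟨rfl, h⟩
    rcases (D.isLink e).eq_and_eq_or_eq_and_eq hl with ⟨h1, h2⟩ | ⟨h1, h2⟩
    · exact ⟨f e, hne, fun v => by rw [h1, h2]; push_cast; ring⟩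
    · exact ⟨- f e, neg_ne_zero.2 hne, fun v => by rw [h1, h2]; push_cast; ring⟩
  have huniv : (univ : Finset completeFour.edgeSet) =
      {⟨s(0, 1), hmem 0 1 (by decide)⟩, ⟨s(0, 2), hmem 0 2 (by decide)⟩,
        ⟨s(0, 3), hmem 0 3 (by decide)⟩, ⟨s(1, 2), hmem 1 2 (by decide)⟩,
        ⟨s(1, 3), hmem 1 3 (by decide)⟩, ⟨s(2, 3), hmem 2 3 (by decide)⟩} := by
    ext ⟨e, he⟩
    obtain ⟨x, y, hl⟩ := exists_isLink_of_mem_edgeSet he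
    obtain ⟨rfl, hxy⟩ := completeFour_isLink.1 hl
    simp only [mem_univ, mem_insert, mem_singleton, true_iff, Subtype.mk.injEq]
    clear he hl
    revert x y
    decide
  obtain ⟨a, ha, ha'⟩ := hσ 0 1 (by decide)
  obtain ⟨b, hb, hb'⟩ := hσ 0 2 (by decide)
  obtain ⟨c, hc, hc'⟩ := hσ 0 3 (by decide)
  obtain ⟨d, hd, hd'⟩ := hσ 1 2 (by decide)
  obtain ⟨k, hk, hk'⟩ := hσ 1 3 (by decide)
  obtain ⟨l, hl, hl'⟩ := hσ 2 3 (by decide)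
  have heq : ∀ v : Fin 4, a * ((if 0 = v then 1 else 0) - (if 1 = v then 1 else 0)) +
      (b * ((if 0 = v then 1 else 0) - (if 2 = v then 1 else 0)) +
      (c * ((if 0 = v then 1 else 0) - (if 3 = v then 1 else 0)) +
      (d * ((if 1 = v then 1 else 0) - (if 2 = v then 1 else 0)) +
      (k * ((if 1 = v then 1 else 0) - (if 3 = v then 1 else 0)) +
      l * ((if 2 = v then 1 else 0) - (if 3 = v then 1 else 0)))))) = 0 := by
    intro v
    have h1 := congrArg (Int.cast : ℤ → ZMod 3) (hsum v trivial)
    rw [Int.cast_sum, huniv, sum_insert, sum_insert, sum_insert, sum_insert, sum_insert,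
      sum_singleton, ha', hb', hc', hd', hk', hl', Int.cast_zero] at h1
    · exact h1
    all_goals
      simp only [mem_insert, mem_singleton, Subtype.mk.injEq]
      decide
  have h0 := heq 0
  have h1 := heq 1
  have h2 := heq 2
  simp at h0 h1 h2
  have h8 : ∀ x y z : ZMod 3, x ≠ 0 → y ≠ 0 → z ≠ 0 → x + (y + z) = 0 → y = x ∧ z = x := by
    decide
  obtain ⟨h3, h4⟩ := h8 a b c ha hb hc (by linear_combination h0)
  obtain ⟨h5, h6⟩ := h8 (-a) d k (neg_ne_zero.2 ha) hd hk (by linear_combination h1)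
  obtain ⟨h7, -⟩ := h8 (-b) (-d) l (neg_ne_zero.2 hb) (neg_ne_zero.2 hd) hl
    (by linear_combination h2)
  rw [h3, h5] at h7
  exact (by decide : ∀ x : ZMod 3, x ≠ 0 → - -x ≠ -x) a ha h7

end Graph

end GraphFlow

theorem theorem1p14 :
    (∀ (α : Type*) (β : Type*) (G : Graph α β),
      G.vertexSet.Finite → G.edgeSet.Finite → G.Loopless → G.Bridgeless →
      G.edgeCutsOfSize 5 = ∅ → (G.edgeCutsOfSize 3).encard ≤ 3 →
      G.HasNowhereZeroThreeFlow) ∧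
    (Graph.completeFour.Bridgeless ∧
      Graph.completeFour.edgeCutsOfSize 5 = ∅ ∧
      (Graph.completeFour.edgeCutsOfSize 3).encard = 4 ∧
      ¬ Graph.completeFour.HasNowhereZeroThreeFlow) :=
  ⟨fun _ _ _ hV hE _ hb h5 h3 => Graph.hasNowhereZeroThreeFlow hV hE hb h5 h3,
    Graph.completeFour_bridgeless, Graph.edgeCutsOfSize_five_completeFour,
    Graph.encard_edgeCutsOfSize_three_completeFour,
    Graph.not_hasNowhereZeroThreeFlow_completeFour⟩
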